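/- **Theorem 5.1.** Consider the discrete-time single-server queue with two classes of customers under preemptive priority, in an early arrival system. In each slot a high-priority customer arrives with probability $p$ and a low-priority customer arrives with probability $q$. After these arrivals, if a high-priority customer is present, one of them is in service and departs at the end of the slot with probability $\mu_h$; otherwise, if a low-priority customer is present, one of them is in service and departs at the end of the slot with probability $\mu_l$. All these Bernoulli events are independent. Write $\bar x=1-x$. Assume that $p,q,\mu_h,\mu_l>0$, $p+q+\mu_h+\mu_l=1$, $\mu_l\le\mu_h$ and $\rho=\frac{p}{\mu_h}+\frac{q}{\mu_l}<1$, and let $(\pi_{i,j})_{i,j\ge 0}$ be the joint stationary distribution of the numbers $i$ of high-priority and $j$ of low-priority customers at the slot division points. Put $$y_0=\frac{p\mu_h+\bar p\bar\mu_h-2\sqrt{p\mu_h\bar p\bar\mu_h}}{(p\mu_h-\bar p\bar\mu_h)^2q}-\frac{\bar q}{q},\qquad y_1=\frac{p\mu_h+\bar p\bar\mu_h+2\sqrt{p\mu_h\bar p\bar\mu_h}}{(p\mu_h-\bar p\bar\mu_h)^2q}-\frac{\bar q}{q},$$ $$F(y)=(\bar p+\mu_h-2\bar p\mu_l)q\,y^2+\big[(\bar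 p+\mu_h-2\bar p\mu_l)\bar q+2\bar p q\mu_l-1\big]y+2\bar p\bar q\mu_l,$$ $$B=1-\mu_h\bar q-\bar p\bar q\bar\mu_l-\bar p q\mu_l,\qquad \eta_{1}=\frac{B+\sqrt{B^2+4\bar p\bar q(\mu_h-\bar p\mu_l)\bar\mu_l q}}{2\bar p\bar q\mu_l},\qquad \eta_{2}=\frac{B-\sqrt{B^2+4\bar p\bar q(\mu_h-\bar p\mu_l)\bar\mu_l q}}{2\bar p\bar q\mu_l},$$ $$\varpi=\frac{1-\rho}{\bar p\bar q},\qquad a=\frac{\varpi}{2\bar p\mu_l}\,\frac{\eta_1}{\eta_1-\eta_2},\qquad b=\frac{\varpi}{2\bar p\mu_l}\,\frac{\eta_2}{\eta_2-\eta_1},$$ $$C_{l,1}=\frac{2aF(1/\eta_1)}{q\eta_1^{-1}+\bar q},\qquad C_{l,2}=\frac{a(\bar p-\mu_h)q\,y_0\sqrt{y_0(y_1-y_0)}}{(qy_0+\bar q)\sqrt{\pi}},$$ $$C_{l,3}=\left[\frac{a}{(qy_0+\bar q)(1-\eta_1y_0)}+\frac{b}{(qy_0+\bar q)(1-\eta_2y_0)}\right]\frac{(\mu_h-\bar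 p)q}{2\sqrt{\pi}}\;y_0\sqrt{y_0(y_1-y_0)},$$ where $\pi$ without indices is the number $\pi$. Write $f(j)\sim g(j)$ for $\lim_{j\to\infty}f(j)/g(j)=1$. Then: (i) if $F(y_0)>0$, then $\pi_{0,j}\sim C_{l,1}\,\eta_1^{\,j}$; (ii) if $F(y_0)=0$, then $\pi_{0,j}\sim C_{l,2}\,j^{-1/2}\,y_0^{-j}$; (iii) if $F(y_0)<0$, then $\pi_{0,j}\sim C_{l,3}\,j^{-3/2}\,y_0^{-j}$. -/

import Mathlib

/-! Discrete-time single-server preemptive priority queue with two classes of customers, early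
arrival system.  Parameters: arrival probabilities `p` (high priority) and `q` (low priority),
service completion probabilities `μh` and `μl`.  A state `(i, j)` records `i` high-priority and
`j` low-priority customers. -/

noncomputable section

namespace PriorityQueue

/-- The mass that a Bernoulli variable with success probability `r` gives to the value `b`. -/
def bern (r : ℝ) (b : Bool) : ℝ := if b then r else 1 - r

/-- State at the next slot division point.  During a slot the arrivals `aH`, `aL` come first; then
the customer in service may depart.  If a high-priority customer is present, one is in
service and departs when `dH` holds; otherwise a low-priority customer, if there is one, is in
service and departs when `dL` holds (when there is none, the truncated subtraction leaves `0`). -/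
def slotStep (s : ℕ × ℕ) (aH aL dH dL : Bool) : ℕ × ℕ :=
  if 0 < s.1 + aH.toNat then (s.1 + aH.toNat - dH.toNat, s.2 + aL.toNat)
  else (0, s.2 + aL.toNat - dL.toNat)

/-- One-step transition probability from `s` to `t`: the arrivals and the service completions
are independent Bernoulli variables. -/
def transProb (p q μh μl : ℝ) (s t : ℕ × ℕ) : ℝ :=
  ∑ aH : Bool, ∑ aL : Bool, ∑ dH : Bool, ∑ dL : Bool,
    if slotStep s aH aL dH dL = t then bern p aH * bern q aL * bern μh dH * bern μl dL else 0

/-- `π` is a stationary probability distribution of the queue-length chain. -/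
structure IsStationary (p q μh μl : ℝ) (π : ℕ × ℕ → ℝ) : Prop where
  nonneg : ∀ s, 0 ≤ π s
  hasSum_one : HasSum π 1
  balance : ∀ t, HasSum (fun s => π s * transProb p q μh μl s t) (π t)

/-- The traffic intensity `ρ = p / μh + q / μl`. -/
def rho (p q μh μl : ℝ) : ℝ := p / μh + q / μl

/-- The empty-system probability `π₀₀ = (1 - ρ) / ((1 - p) (1 - q))`. -/
def pi00 (p q μh μl : ℝ) : ℝ := (1 - rho p q μh μl) / ((1 - p) * (1 - q))

/-- The smaller branch point. -/
def y0 (p q μh : ℝ) : ℝ :=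
  (p * μh + (1 - p) * (1 - μh) - 2 * √(p * μh * (1 - p) * (1 - μh))) /
    ((p * μh - (1 - p) * (1 - μh)) ^ 2 * q) - (1 - q) / q

/-- The larger branch point. -/
def y1 (p q μh : ℝ) : ℝ :=
  (p * μh + (1 - p) * (1 - μh) + 2 * √(p * μh * (1 - p) * (1 - μh))) /
    ((p * μh - (1 - p) * (1 - μh)) ^ 2 * q) - (1 - q) / q

/-- The quadratic polynomial whose sign at the branch point `y0` separates the three regimes. -/
def F (p q μh μl y : ℝ) : ℝ :=
  ((1 - p) + μh - 2 * (1 - p) * μl) * q * y ^ 2 +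
    (((1 - p) + μh - 2 * (1 - p) * μl) * (1 - q) + 2 * (1 - p) * q * μl - 1) * y +
    2 * (1 - p) * (1 - q) * μl

/-- The linear coefficient in the quadratic equation for `η₁` and `η₂`. -/
def etaB (p q μh μl : ℝ) : ℝ :=
  1 - μh * (1 - q) - (1 - p) * (1 - q) * (1 - μl) - (1 - p) * q * μl

/-- The discriminant in the quadratic equation for `η₁` and `η₂`. -/
def etaDisc (p q μh μl : ℝ) : ℝ :=
  etaB p q μh μl ^ 2 + 4 * (1 - p) * (1 - q) * (μh - (1 - p) * μl) * (1 - μl) * q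

/-- The positive root `η₁`. -/
def eta1 (p q μh μl : ℝ) : ℝ :=
  (etaB p q μh μl + √(etaDisc p q μh μl)) / (2 * (1 - p) * (1 - q) * μl)

/-- The negative root `η₂`. -/
def eta2 (p q μh μl : ℝ) : ℝ :=
  (etaB p q μh μl - √(etaDisc p q μh μl)) / (2 * (1 - p) * (1 - q) * μl)

/-- The partial-fraction coefficient `a`. -/
def coeffA (p q μh μl : ℝ) : ℝ :=
  pi00 p q μh μl / (2 * (1 - p) * μl) *
    (eta1 p q μh μl / (eta1 p q μh μl - eta2 p q μh μl))

/-- The partial-fraction coefficient `b`. -/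
def coeffB (p q μh μl : ℝ) : ℝ :=
  pi00 p q μh μl / (2 * (1 - p) * μl) *
    (eta2 p q μh μl / (eta2 p q μh μl - eta1 p q μh μl))

/-- The constant of the exact geometric regime. -/
def Cl1 (p q μh μl : ℝ) : ℝ :=
  2 * coeffA p q μh μl * F p q μh μl (1 / eta1 p q μh μl) / (q * (eta1 p q μh μl)⁻¹ + (1 - q))

/-- The constant of the regime with prefactor `j ^ (-1/2)`. -/
def Cl2 (p q μh μl : ℝ) : ℝ :=
  coeffA p q μh μl * ((1 - p) - μh) * q * y0 p q μh *
      √(y0 p q μh * (y1 p q μh - y0 p q μh)) /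
    ((q * y0 p q μh + (1 - q)) * √Real.pi)

/-- The constant of the regime with prefactor `j ^ (-3/2)`. -/
def Cl3 (p q μh μl : ℝ) : ℝ :=
  (coeffA p q μh μl / ((q * y0 p q μh + (1 - q)) * (1 - eta1 p q μh μl * y0 p q μh)) +
      coeffB p q μh μl / ((q * y0 p q μh + (1 - q)) * (1 - eta2 p q μh μl * y0 p q μh))) *
    ((μh - (1 - p)) * q / (2 * √Real.pi)) * y0 p q μh *
    √(y0 p q μh * (y1 p q μh - y0 p q μh))

end PriorityQueue

end

/-!
Let `w = q y + 1 - q` and let `G(y) = ∑ⱼ π(0,j) yʲ`.  Summing the balance equations against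
`x^i y^j` gives a functional equation between the joint generating function and `G`.  On the root
`x ∈ (0, 1)` of the kernel `x = w (p x + 1 - p) (μh + (1 - μh) x)` the joint generating function
drops out and `G` is determined; after rationalization
`G(y) = c (F(y) + y √Δ(y)) / (w (1 - η₁ y) (1 - η₂ y))`
with `Δ(y) = d² (y₀ - y) (y₁ - y)` and `d = (1 - p - μh) q`
(`IsStationary.boundaryGen_mul_etaPoly`, `Params.etaPoly_eq`, `Params.kernelDisc_eq`).  Letting
`y → 1` gives `π(0,0)` and hence `c = π₀₀ / (2 (1 - p) μl)` (`IsStationary.apply_zero`).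

The coefficients of `G` are found without contour integration.  The function `√Δ` is, up to a
linear polynomial, a Stieltjes transform: for `z ≤ y₀`,
`∫ √((t - y₀) (y₁ - t)) / (t - z) dt = π ((y₀ + y₁) / 2 - z - √((y₀ - z) (y₁ - z)))`
over the cut `[y₀, y₁]` (`integral_cutWeight_inv`; all integrals over the cut are written in a
rational parameter `s` that makes the square root rational).  So the numerator of `G` is a quadratic
polynomial minus a Cauchy integral, and three successive divided differences, at the zeros of
`w (1 - η₂ y) (1 - η₁ y)`, remove the polynomial (`division_formula`).  The numerator vanishes at
the two negative zeros, because its conjugate `F(y) - y √Δ(y)` is bounded below for `y < 0`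
(`Params.conj_lower`).  Expanding the remaining Cauchy integral in powers of `y` gives the exact
formula `Params.boundary_eq`: `π(0,n)` is a multiple of `η₁ⁿ`, whose coefficient is proportional to
the numerator of `G` at `1 / η₁`, plus a multiple of the integral
of `t⁻ⁿ` against a density on the cut.

Since `F(y₀)²` is a positive multiple of `η₁ y₀ - 1`, always `1 / η₁ ≤ y₀`, with equality exactly
if `F(y₀) = 0`.  The numerator vanishes at `1 / η₁` if `F(y₀) ≤ 0` and not if `F(y₀) > 0`, since `F`
keeps its sign on `(1 / η₁, y₀]`.  Thus for `F(y₀) > 0` the geometric term dominates.  Otherwise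
only the moments are left, and Laplace's method (`tendsto_laplace`) gives their size: the density
behaves like `√(t - y₀)` near `y₀` if `F(y₀) < 0`, and like `1 / √(t - y₀)` if `F(y₀) = 0`, when
`1 / η₁` meets the end of the cut.
-/

namespace PriorityQueue

open MeasureTheory Filter Set Topology

/-! ### The semicircle weight on the cut `[a, b]` -/

/-- Rational parametrization `s ↦ t` of the cut `[a, b)` by `s ∈ [0, ∞)`: it is chosen so that
`√((t - a) (b - t))` is rational in `s`. -/
noncomputable def cutPoint (a b s : ℝ) : ℝ := (a + b * s ^ 2) / (1 + s ^ 2)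

/-- The weight `√((t - a) (b - t)) dt`, written in the variable `s` of `cutPoint`. -/
noncomputable def cutWeight (a b s : ℝ) : ℝ := 2 * (b - a) ^ 2 * s ^ 2 / (1 + s ^ 2) ^ 3

/-- The integral `∫ f(t) √((t - a) (b - t)) dt` over the cut `[a, b]`. -/
noncomputable def cutIntegral (a b : ℝ) (f : ℝ → ℝ) : ℝ :=
  ∫ s in Ioi (0 : ℝ), cutWeight a b s * f (cutPoint a b s)

lemma cutWeight_nonneg (a b s : ℝ) : 0 ≤ cutWeight a b s := by
  unfold cutWeight; positivity

lemma lt_cutPoint {a b s : ℝ} (hab : a < b) (hs : 0 < s) : a < cutPoint a b s := by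
  unfold cutPoint
  rw [lt_div_iff₀ (by positivity)]
  nlinarith [mul_pos (sub_pos.2 hab) (pow_pos hs 2)]

lemma cutPoint_lt {a b : ℝ} (hab : a < b) (s : ℝ) : cutPoint a b s < b := by
  unfold cutPoint
  rw [div_lt_iff₀ (by positivity)]
  linarith

lemma cutPoint_mem_Icc {a b s : ℝ} (hab : a < b) (hs : 0 < s) : cutPoint a b s ∈ Icc a b :=
  ⟨(lt_cutPoint hab hs).le, (cutPoint_lt hab s).le⟩

lemma continuous_cutPoint (a b : ℝ) : Continuous (cutPoint a b) := by
  unfold cutPoint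
  exact Continuous.div (by fun_prop) (by fun_prop) fun s => by positivity

lemma continuous_cutWeight (a b : ℝ) : Continuous (cutWeight a b) := by
  unfold cutWeight
  exact Continuous.div (by fun_prop) (by fun_prop) fun s => by positivity

/-- A primitive of `s² / ((1 + s²)² (α + β s²))`, by partial fractions in `s²`.  At `α = 0` the
last term disappears, since then its coefficient is zero. -/
noncomputable def cutPrimitive (α β s : ℝ) : ℝ :=
  α / (β - α) ^ 2 * Real.arctan s + 1 / (β - α) * ((s / (1 + s ^ 2) + Real.arctan s) / 2) -
    √(α * β) / (β - α) ^ 2 * Real.arctan (√(β / α) * s)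

lemma hasDerivAt_cutPrimitive {α β : ℝ} (hα : 0 ≤ α) (hαβ : α < β) {s : ℝ} (hs : 0 < s) :
    HasDerivAt (cutPrimitive α β)
      (s ^ 2 / ((1 + s ^ 2) ^ 2 * (α + β * s ^ 2))) s := by
  have hβ : 0 < β := hα.trans_lt hαβ
  have hd : β - α ≠ 0 := (sub_pos.2 hαβ).ne'
  have h1 : (1 + s ^ 2 : ℝ) ≠ 0 := by positivity
  have hA := Real.hasDerivAt_arctan s
  have hR : HasDerivAt (fun s : ℝ => s / (1 + s ^ 2))
      ((1 * (1 + s ^ 2) - s * (2 * s)) / (1 + s ^ 2) ^ 2) s := by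
    refine (hasDerivAt_id s).div ?_ h1
    simpa using ((hasDerivAt_id s).pow 2).const_add 1
  have hB : HasDerivAt (fun s : ℝ => Real.arctan (√(β / α) * s))
      (1 / (1 + (√(β / α) * s) ^ 2) * √(β / α)) s := by
    have := ((hasDerivAt_id s).const_mul √(β / α)).arctan
    simpa using this
  have := ((hA.const_mul (α / (β - α) ^ 2)).add
    (((hR.add hA).div_const 2).const_mul (1 / (β - α)))).sub
      (hB.const_mul (√(α * β) / (β - α) ^ 2))
  refine this.congr_deriv ?_
  rcases hα.eq_or_lt with rfl | hα'
  · simp only [zero_mul, Real.sqrt_zero, zero_div, sub_zero, zero_add]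
    have := hs.ne'
    field_simp
    ring
  · have h2 : α + β * s ^ 2 ≠ 0 := by positivity
    have h3 : √(α * β) * √(β / α) = β := by
      rw [← Real.sqrt_mul (by positivity), show α * β * (β / α) = β ^ 2 by field_simp,
        Real.sqrt_sq hβ.le]
    have h4 : √(α * β) / (β - α) ^ 2 * (1 / (1 + (√(β / α) * s) ^ 2) * √(β / α)) =
        β * α / ((β - α) ^ 2 * (α + β * s ^ 2)) := by
      rw [mul_pow, Real.sq_sqrt (by positivity)]
      have : 1 + β / α * s ^ 2 ≠ 0 := by positivity
      calc _ = (√(α * β) * √(β / α)) / ((β - α) ^ 2 * (1 + β / α * s ^ 2)) := by field_simp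
        _ = _ := by rw [h3]; field_simp
    rw [h4]
    field_simp
    ring

lemma tendsto_cutPrimitive {α β : ℝ} (hα : 0 ≤ α) (hαβ : α < β) :
    Tendsto (cutPrimitive α β) atTop
      (𝓝 (α / (β - α) ^ 2 * (Real.pi / 2) + 1 / (β - α) * ((0 + Real.pi / 2) / 2) -
        √(α * β) / (β - α) ^ 2 * (Real.pi / 2))) := by
  have hβ : 0 < β := hα.trans_lt hαβ
  have hA : Tendsto Real.arctan atTop (𝓝 (Real.pi / 2)) :=
    Real.tendsto_arctan_atTop.mono_right nhdsWithin_le_nhds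
  have hR : Tendsto (fun s : ℝ => s / (1 + s ^ 2)) atTop (𝓝 0) := by
    refine squeeze_zero' (g := fun s => s⁻¹) ?_ ?_ tendsto_inv_atTop_zero
    · filter_upwards [eventually_gt_atTop 0] with s hs using by positivity
    · filter_upwards [eventually_gt_atTop 0] with s hs
      rw [div_le_iff₀ (by positivity)]
      field_simp
      nlinarith
  have hB : Tendsto (fun s : ℝ => √(α * β) / (β - α) ^ 2 * Real.arctan (√(β / α) * s)) atTop
      (𝓝 (√(α * β) / (β - α) ^ 2 * (Real.pi / 2))) := by
    rcases hα.eq_or_lt with rfl | hα'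
    · simp
    · refine (hA.comp ?_).const_mul _
      exact tendsto_id.const_mul_atTop (Real.sqrt_pos.2 (by positivity))
  exact ((hA.const_mul _).add (((hR.add hA).div_const 2).const_mul _)).sub hB

lemma cutWeight_div_eq {a b z s : ℝ} (hab : a < b) (hz : z ≤ a) (hs : 0 < s) :
    cutWeight a b s * (cutPoint a b s - z)⁻¹ =
      2 * (b - a) ^ 2 *
        (s ^ 2 / ((1 + s ^ 2) ^ 2 * ((a - z) + (b - z) * s ^ 2))) := by
  have h1 : (0 : ℝ) < 1 + s ^ 2 := by positivity
  have h2 : 0 < (a - z) + (b - z) * s ^ 2 := by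
    have : 0 < b - z := by linarith
    have : 0 ≤ a - z := by linarith
    positivity
  have h3 : cutPoint a b s - z = ((a - z) + (b - z) * s ^ 2) / (1 + s ^ 2) := by
    unfold cutPoint; field_simp; ring
  rw [h3, cutWeight, inv_div]
  field_simp

/-- The Stieltjes transform of the semicircle weight, to the left of the cut and at its left
end. -/
lemma integral_cutWeight_inv {a b z : ℝ} (hab : a < b) (hz : z ≤ a) :
    IntegrableOn (fun s => cutWeight a b s * (cutPoint a b s - z)⁻¹) (Ioi 0) ∧
    cutIntegral a b (fun t => (t - z)⁻¹) =
      Real.pi * ((a + b) / 2 - z - √((a - z) * (b - z))) := by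
  have hα : 0 ≤ a - z := by linarith
  have hαβ : a - z < b - z := by linarith
  have hβ : 0 < b - z := by linarith
  have hcont : ContinuousWithinAt (cutPrimitive (a - z) (b - z)) (Ici 0) 0 := by
    unfold cutPrimitive
    refine Continuous.continuousWithinAt ?_
    have : Continuous fun s : ℝ => s / (1 + s ^ 2) :=
      Continuous.div (by fun_prop) (by fun_prop) fun s => by positivity
    have h' : Continuous Real.arctan := Real.continuous_arctan
    fun_prop
  have hd := fun s (hs : s ∈ Ioi (0 : ℝ)) => hasDerivAt_cutPrimitive hα hαβ hs
  have hpos : ∀ s ∈ Ioi (0 : ℝ),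
      0 ≤ s ^ 2 / ((1 + s ^ 2) ^ 2 * ((a - z) + (b - z) * s ^ 2)) := fun s _ => by positivity
  have hlim := tendsto_cutPrimitive hα hαβ
  have hint := integrableOn_Ioi_deriv_of_nonneg hcont hd hpos hlim
  have hval := integral_Ioi_of_hasDerivAt_of_nonneg hcont hd hpos hlim
  constructor
  · refine IntegrableOn.congr_fun (hint.const_mul (2 * (b - a) ^ 2)) (fun s hs => ?_)
      measurableSet_Ioi
    exact (cutWeight_div_eq hab hz hs).symm
  · unfold cutIntegral
    rw [setIntegral_congr_fun measurableSet_Ioi fun s hs => cutWeight_div_eq hab hz hs,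
      integral_const_mul, hval]
    have : b - a ≠ 0 := (sub_pos.2 hab).ne'
    simp only [cutPrimitive, Real.arctan_zero, mul_zero, zero_div, add_zero, zero_add, sub_zero,
      sub_sub_sub_cancel_right]
    field_simp
    ring

/-- Integrability on the cut, with at most a simple pole at its left end. -/
lemma integrableOn_cut {a b ζ : ℝ} (hab : a < b) (hζ : ζ ≤ a) {g : ℝ → ℝ}
    (hg : ContinuousOn g (Icc a b)) :
    IntegrableOn (fun s => cutWeight a b s * (g (cutPoint a b s) / (cutPoint a b s - ζ)))
      (Ioi 0) := by
  obtain ⟨C, hC⟩ := isCompact_Icc.exists_bound_of_continuousOn hg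
  have hI := (integral_cutWeight_inv hab hζ).1
  have hne : ∀ s ∈ Ioi (0 : ℝ), cutPoint a b s - ζ ≠ 0 := fun s hs =>
    (sub_pos.2 (hζ.trans_lt (lt_cutPoint hab hs))).ne'
  refine Integrable.mono' (hI.const_mul C) ?_ ?_
  · refine ContinuousOn.aestronglyMeasurable ?_ measurableSet_Ioi
    refine (continuous_cutWeight a b).continuousOn.mul (ContinuousOn.div ?_ ?_ hne)
    · exact hg.comp (continuous_cutPoint a b).continuousOn fun s hs => cutPoint_mem_Icc hab hs
    · exact ((continuous_cutPoint a b).sub continuous_const).continuousOn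
  · filter_upwards [ae_restrict_mem measurableSet_Ioi] with s hs
    have h1 := hC _ (cutPoint_mem_Icc hab hs)
    have h2 : 0 < cutPoint a b s - ζ := sub_pos.2 (hζ.trans_lt (lt_cutPoint hab hs))
    rw [norm_mul, norm_div, Real.norm_of_nonneg (cutWeight_nonneg a b s), Real.norm_of_nonneg h2.le,
      div_eq_mul_inv, mul_left_comm]
    exact mul_le_mul_of_nonneg_right h1 (mul_nonneg (cutWeight_nonneg a b s) (inv_nonneg.2 h2.le))

lemma integrableOn_cut' {a b : ℝ} (hab : a < b) {g : ℝ → ℝ} (hg : ContinuousOn g (Icc a b)) :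
    IntegrableOn (fun s => cutWeight a b s * g (cutPoint a b s)) (Ioi 0) := by
  have h := integrableOn_cut hab (sub_le_self a zero_le_one)
    (g := fun t => g t * (t - (a - 1))) (hg.mul (by fun_prop))
  refine h.congr_fun (fun s hs => ?_) measurableSet_Ioi
  have h2 : cutPoint a b s - (a - 1) ≠ 0 := by
    have := lt_cutPoint hab hs
    exact (by linarith : 0 < cutPoint a b s - (a - 1)).ne'
  simp only [mul_div_assoc, div_self h2, mul_one]

lemma continuousOn_div_sub {a b ζ : ℝ} (hζ : ζ < a) {g : ℝ → ℝ} (hg : ContinuousOn g (Icc a b)) :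
    ContinuousOn (fun t => g t / (t - ζ)) (Icc a b) :=
  hg.div (by fun_prop) fun t ht => (sub_pos.2 (hζ.trans_le ht.1)).ne'

/-- Divided difference of a Cauchy-type integral over the cut. -/
lemma cutIntegral_sub {a b y ζ : ℝ} (hab : a < b) (hy : y ≤ a) (hζ : ζ < a) {g : ℝ → ℝ}
    (hg : ContinuousOn g (Icc a b)) :
    cutIntegral a b (fun t => g t / (t - y)) - cutIntegral a b (fun t => g t / (t - ζ)) =
      (y - ζ) * cutIntegral a b (fun t => g t / (t - ζ) / (t - y)) := by
  unfold cutIntegral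
  rw [← integral_const_mul, ← integral_sub (integrableOn_cut hab hy hg)
    (integrableOn_cut hab hζ.le hg)]
  refine setIntegral_congr_fun measurableSet_Ioi fun s hs => ?_
  have h := lt_cutPoint hab hs
  have h1 : cutPoint a b s - y ≠ 0 := (sub_pos.2 (hy.trans_lt h)).ne'
  have h2 : cutPoint a b s - ζ ≠ 0 := (sub_pos.2 (hζ.trans h)).ne'
  simp only
  field_simp
  ring

lemma cutIntegral_id_div {a b y : ℝ} (hab : a < b) (hy : y ≤ a) :
    cutIntegral a b (fun t => t / (t - y)) =
      cutIntegral a b (fun _ => 1) + y * cutIntegral a b (fun t => (t - y)⁻¹) := by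
  unfold cutIntegral
  rw [← integral_const_mul, ← integral_add (integrableOn_cut' hab continuousOn_const)
    ((integral_cutWeight_inv hab hy).1.const_mul y)]
  refine setIntegral_congr_fun measurableSet_Ioi fun s hs => ?_
  have h1 : cutPoint a b s - y ≠ 0 := (sub_pos.2 (hy.trans_lt (lt_cutPoint hab hs))).ne'
  simp only
  field_simp
  ring

/-- Expansion in powers of `y` of a Cauchy-type integral over the cut. -/
lemma hasSum_cutIntegral {a b y ζ : ℝ} (ha : 0 < a) (hab : a < b) (hζ : ζ ≤ a) (hy0 : 0 < y)
    (hya : y < a) {g : ℝ → ℝ} (hg : ContinuousOn g (Icc a b)) :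
    HasSum (fun n : ℕ => cutIntegral a b (fun t => g t * t⁻¹ ^ n / (t - ζ)) * y ^ n)
      (cutIntegral a b (fun t => t * g t / (t - y) / (t - ζ))) := by
  have hpow : ∀ n : ℕ, ContinuousOn (fun t => g t * t⁻¹ ^ n * y ^ n) (Icc a b) := fun n =>
    (hg.mul ((continuousOn_id.inv₀ fun t ht => (ha.trans_le ht.1).ne').pow n)).mul
      continuousOn_const
  have hint := fun n => integrableOn_cut hab hζ (hpow n)
  have hfac : ∀ s ∈ Ioi (0 : ℝ), 0 ≤ (cutPoint a b s)⁻¹ * y ∧ (cutPoint a b s)⁻¹ * y ≤ y / a := by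
    intro s hs
    have h := lt_cutPoint hab hs
    have h0 := ha.trans h
    refine ⟨by positivity, ?_⟩
    rw [div_eq_inv_mul]
    gcongr
  have key := hasSum_integral_of_summable_integral_norm (μ := volume.restrict (Ioi (0 : ℝ))) hint ?_
  · unfold cutIntegral
    convert! key using 1
    · funext n
      rw [← integral_mul_const]
      congr 1; funext s; ring
    · refine setIntegral_congr_fun measurableSet_Ioi fun s hs => ?_
      have h := lt_cutPoint hab hs
      have h0 := ha.trans h
      have h1 : cutPoint a b s - y ≠ 0 := (sub_pos.2 (hya.trans h)).ne'
      have hlt : (cutPoint a b s)⁻¹ * y < 1 :=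
        (hfac s hs).2.trans_lt ((div_lt_one ha).2 hya)
      have hs' := (hasSum_geometric_of_lt_one (hfac s hs).1 hlt).mul_left
        (cutWeight a b s * (g (cutPoint a b s) / (cutPoint a b s - ζ)))
      rw [tsum_congr (fun n => ?_), hs'.tsum_eq]
      · have : 1 - (cutPoint a b s)⁻¹ * y ≠ 0 := by linarith
        have e : (1 - (cutPoint a b s)⁻¹ * y)⁻¹ = cutPoint a b s / (cutPoint a b s - y) := by
          field_simp
        simp only
        rw [e]; ring
      · rw [mul_pow]; ring
  · refine Summable.of_nonneg_of_le (fun n => integral_nonneg fun s => norm_nonneg _) (fun n => ?_)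
      ((summable_geometric_of_lt_one (div_nonneg hy0.le ha.le) ((div_lt_one ha).2 hya)).mul_left
        (∫ s in Ioi (0 : ℝ), ‖cutWeight a b s * (g (cutPoint a b s) / (cutPoint a b s - ζ))‖))
    rw [← integral_mul_const]
    refine setIntegral_mono_on (hint n).norm ((integrableOn_cut hab hζ hg).norm.mul_const _)
      measurableSet_Ioi fun s hs => ?_
    have e : cutWeight a b s * (g (cutPoint a b s) * (cutPoint a b s)⁻¹ ^ n * y ^ n /
        (cutPoint a b s - ζ)) = cutWeight a b s * (g (cutPoint a b s) / (cutPoint a b s - ζ)) *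
          ((cutPoint a b s)⁻¹ * y) ^ n := by rw [mul_pow]; ring
    rw [e, norm_mul, norm_pow, Real.norm_of_nonneg (hfac s hs).1]
    gcongr
    · exact (hfac s hs).1
    · exact (hfac s hs).2

/-! ### Laplace's method at the left end of the cut -/

/-- A Bernoulli inequality with quadratic gain, uniform for `x` in a bounded interval. -/
lemma sq_one_add_mul_le_pow {x κ : ℝ} (hx : 0 ≤ x) (hxκ : x ≤ κ) (n : ℕ) :
    (1 + n * x * (1 + √(1 + κ))⁻¹) ^ 2 ≤ (1 + x) ^ n := by
  have hr := Real.sq_sqrt (show 0 ≤ 1 + x by linarith)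
  have hr1 : 1 ≤ √(1 + x) := Real.one_le_sqrt.2 (by linarith)
  have hrκ : √(1 + x) ≤ √(1 + κ) := Real.sqrt_le_sqrt (by linarith)
  have h1 : 1 + (n : ℝ) * (√(1 + x) - 1) ≤ √(1 + x) ^ n := by
    simpa using one_add_mul_le_pow (a := √(1 + x) - 1) (by linarith) n
  have h2 : x * (1 + √(1 + κ))⁻¹ ≤ √(1 + x) - 1 := by
    rw [← div_eq_mul_inv, div_le_iff₀ (by positivity)]
    nlinarith
  have h3 : 1 + n * x * (1 + √(1 + κ))⁻¹ ≤ √(1 + x) ^ n := by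
    refine le_trans ?_ h1
    rw [mul_assoc]
    gcongr
  calc (1 + n * x * (1 + √(1 + κ))⁻¹) ^ 2 ≤ (√(1 + x) ^ n) ^ 2 := by gcongr
    _ = (1 + x) ^ n := by rw [← pow_mul, mul_comm n 2, pow_mul, hr]

/-- Laplace's method for `∫ s^(2e) (1 + s²)⁻² h(s) (1 + κ s² / (1 + s²))⁻ⁿ ds`, by the substitution
`s = v / √n`. -/
lemma tendsto_laplace {κ C L : ℝ} (hκ : 0 < κ) {h : ℝ → ℝ} (hcont : ContinuousOn h (Ioi 0))
    (hC : ∀ s, 0 < s → |h s| ≤ C) (hL : Tendsto h (𝓝[>] 0) (𝓝 L)) {e : ℕ} (he : e ≤ 1) :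
    Tendsto (fun n : ℕ => (√n) ^ (2 * e + 1) * ∫ s in Ioi (0 : ℝ),
        s ^ (2 * e) / (1 + s ^ 2) ^ 2 * h s * ((1 + κ * (s ^ 2 / (1 + s ^ 2))) ^ n)⁻¹) atTop
      (𝓝 (L * ∫ v in Ioi (0 : ℝ), v ^ (2 * e) * Real.exp (-κ * v ^ 2))) := by
  have hC0 : 0 ≤ C := (abs_nonneg _).trans (hC 1 one_pos)
  set c : ℝ := (1 + √(1 + κ))⁻¹ with hc
  have hc0 : 0 < c := by positivity
  -- the integrands are dominated by `C m⁻² / (1 + v²)`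
  obtain ⟨m, hm0, hm1, hmc⟩ : ∃ m : ℝ, 0 < m ∧ m ≤ 1 ∧ m ≤ c * κ :=
    ⟨min 1 (c * κ), lt_min one_pos (mul_pos hc0 hκ), min_le_left _ _, min_le_right _ _⟩
  set G : ℕ → ℝ → ℝ := fun n s =>
    s ^ (2 * e) / (1 + s ^ 2) ^ 2 * h s * ((1 + κ * (s ^ 2 / (1 + s ^ 2))) ^ n)⁻¹ with hG
  have hsub : ∀ᶠ n : ℕ in atTop, ∫ v in Ioi (0 : ℝ), √n ^ (2 * e) * G n ((√n)⁻¹ * v) =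
      (√n) ^ (2 * e + 1) * ∫ s in Ioi (0 : ℝ), G n s := by
    filter_upwards [eventually_gt_atTop 0] with n hn
    have hn' : 0 < √(n : ℝ) := Real.sqrt_pos.2 (by exact_mod_cast hn)
    rw [integral_const_mul, integral_comp_mul_left_Ioi (G n) 0 (inv_pos.2 hn')]
    simp only [inv_inv, mul_zero, smul_eq_mul]
    ring
  refine Tendsto.congr' hsub ?_
  rw [← integral_const_mul]
  refine tendsto_integral_filter_of_dominated_convergence
    (fun v => C / m ^ 2 * (1 + v ^ 2)⁻¹) ?_ ?_ ?_ ?_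
  · filter_upwards [eventually_gt_atTop 0] with n hn
    have hn' : 0 < √(n : ℝ) := Real.sqrt_pos.2 (by exact_mod_cast hn)
    refine ContinuousOn.aestronglyMeasurable ?_ measurableSet_Ioi
    refine continuousOn_const.mul (ContinuousOn.mul (ContinuousOn.mul ?_ ?_) ?_)
    · exact Continuous.continuousOn (Continuous.div (by fun_prop) (by fun_prop)
        fun s => by positivity)
    · exact hcont.comp (by fun_prop) fun v hv => mul_pos (inv_pos.2 hn') hv
    · refine Continuous.continuousOn (Continuous.inv₀ (Continuous.pow (continuous_const.add
        (continuous_const.mul (Continuous.div (by fun_prop) (by fun_prop)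
        fun s => by positivity))) n) fun s => by positivity)
  · filter_upwards [eventually_gt_atTop 0] with n hn
    have hn0 : (0 : ℝ) < n := by exact_mod_cast hn
    have hn' : 0 < √(n : ℝ) := Real.sqrt_pos.2 hn0
    have hsq : √(n : ℝ) ^ 2 = n := Real.sq_sqrt hn0.le
    filter_upwards [ae_restrict_mem measurableSet_Ioi] with v hv
    have hv0 : (0 : ℝ) < v := hv
    set s := (√(n : ℝ))⁻¹ * v with hs
    have hs0 : 0 < s := by positivity
    have hsv : √(n : ℝ) * s = v := by rw [hs]; field_simp
    have hns : n * s ^ 2 = v ^ 2 := by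
      rw [hs, mul_pow, inv_pow, hsq]; field_simp
    have hx0 : 0 ≤ κ * (s ^ 2 / (1 + s ^ 2)) := by positivity
    have hxκ : κ * (s ^ 2 / (1 + s ^ 2)) ≤ κ := by
      have : s ^ 2 / (1 + s ^ 2) ≤ 1 := by rw [div_le_one (by positivity)]; linarith
      nlinarith
    have hB := sq_one_add_mul_le_pow hx0 hxκ n
    rw [← hc] at hB
    have h1s : (1 + s ^ 2) * (1 + n * (κ * (s ^ 2 / (1 + s ^ 2))) * c) =
        1 + s ^ 2 + c * κ * v ^ 2 := by
      rw [← hns]; field_simp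
    have hlow : (m * (1 + v ^ 2)) ^ 2 ≤
        (1 + s ^ 2) ^ 2 * (1 + κ * (s ^ 2 / (1 + s ^ 2))) ^ n := by
      calc (m * (1 + v ^ 2)) ^ 2 ≤ (1 + s ^ 2 + c * κ * v ^ 2) ^ 2 := by
            have : m * v ^ 2 ≤ c * κ * v ^ 2 := by gcongr
            have : m * (1 + v ^ 2) ≤ 1 + s ^ 2 + c * κ * v ^ 2 := by nlinarith [sq_nonneg s]
            gcongr
        _ = (1 + s ^ 2) ^ 2 * (1 + n * (κ * (s ^ 2 / (1 + s ^ 2))) * c) ^ 2 := by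
            rw [← h1s]; ring
        _ ≤ _ := by gcongr
    have hve : v ^ (2 * e) ≤ 1 + v ^ 2 := by
      interval_cases e
      · simp; positivity
      · simp
    have e1 : √(n : ℝ) ^ (2 * e) * G n s =
        h s * (v ^ (2 * e) / ((1 + s ^ 2) ^ 2 * (1 + κ * (s ^ 2 / (1 + s ^ 2))) ^ n)) := by
      rw [hG, ← hsv, mul_pow]
      simp only
      field_simp
    rw [e1, norm_mul, Real.norm_eq_abs, Real.norm_of_nonneg (by positivity)]
    calc |h s| * (v ^ (2 * e) / ((1 + s ^ 2) ^ 2 * (1 + κ * (s ^ 2 / (1 + s ^ 2))) ^ n))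
        ≤ C * ((1 + v ^ 2) / (m * (1 + v ^ 2)) ^ 2) := by
          gcongr
          exact hC s hs0
      _ = C / m ^ 2 * (1 + v ^ 2)⁻¹ := by field_simp
  · exact (integrable_inv_one_add_sq.const_mul _).integrableOn
  · filter_upwards [ae_restrict_mem measurableSet_Ioi] with v hv
    have hv0 : (0 : ℝ) < v := hv
    have hsq : Tendsto (fun n : ℕ => √(n : ℝ)) atTop atTop :=
      Real.tendsto_sqrt_atTop.comp tendsto_natCast_atTop_atTop
    have hs : Tendsto (fun n : ℕ => (√(n : ℝ))⁻¹ * v) atTop (𝓝 0) := by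
      simpa using (tendsto_inv_atTop_zero.comp hsq).mul_const v
    have hs' : Tendsto (fun n : ℕ => (√(n : ℝ))⁻¹ * v) atTop (𝓝[>] 0) := by
      refine tendsto_nhdsWithin_iff.2 ⟨hs, ?_⟩
      filter_upwards [eventually_gt_atTop 0] with n hn
      have hn' : 0 < √(n : ℝ) := Real.sqrt_pos.2 (by exact_mod_cast hn)
      exact mul_pos (inv_pos.2 hn') hv0
    have h1 : Tendsto (fun n : ℕ => 1 + ((√(n : ℝ))⁻¹ * v) ^ 2) atTop (𝓝 1) := by
      simpa using (hs.pow 2).const_add 1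
    have hx : Tendsto (fun n : ℕ => (n : ℝ) * (κ * (((√(n : ℝ))⁻¹ * v) ^ 2 /
        (1 + ((√(n : ℝ))⁻¹ * v) ^ 2)))) atTop (𝓝 (κ * v ^ 2)) := by
      have : Tendsto (fun n : ℕ => κ * v ^ 2 / (1 + ((√(n : ℝ))⁻¹ * v) ^ 2)) atTop
          (𝓝 (κ * v ^ 2 / 1)) := tendsto_const_nhds.div h1 one_ne_zero
      rw [div_one] at this
      refine this.congr' ?_
      filter_upwards [eventually_gt_atTop 0] with n hn
      have hn0 : (0 : ℝ) < n := by exact_mod_cast hn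
      have e2 : (n : ℝ) * ((√(n : ℝ))⁻¹ * v) ^ 2 = v ^ 2 := by
        rw [mul_pow, inv_pow, Real.sq_sqrt hn0.le]; field_simp
      rw [← e2]; ring
    have hE := (Real.tendsto_one_add_pow_exp_of_tendsto hx).inv₀ (Real.exp_pos _).ne'
    have hW : Tendsto (fun n : ℕ => v ^ (2 * e) / (1 + ((√(n : ℝ))⁻¹ * v) ^ 2) ^ 2) atTop
        (𝓝 (v ^ (2 * e) / 1 ^ 2)) := tendsto_const_nhds.div (h1.pow 2) (by norm_num)
    have := (hW.mul (hL.comp hs')).mul hE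
    rw [← Real.exp_neg, one_pow, div_one] at this
    rw [show L * (v ^ (2 * e) * Real.exp (-κ * v ^ 2)) =
      v ^ (2 * e) * L * Real.exp (-(κ * v ^ 2)) by ring_nf]
    refine this.congr' ?_
    · filter_upwards [eventually_gt_atTop 0] with n hn
      have hn' : 0 < √(n : ℝ) := Real.sqrt_pos.2 (by exact_mod_cast hn)
      have e3 : v ^ (2 * e) = √(n : ℝ) ^ (2 * e) * ((√(n : ℝ))⁻¹ * v) ^ (2 * e) := by
        rw [← mul_pow, mul_inv_cancel_left₀ hn'.ne']
      rw [hG, e3]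
      simp only [Function.comp]
      ring

lemma integral_sq_mul_exp_neg_mul_sq {κ : ℝ} (hκ : 0 < κ) :
    ∫ v in Ioi (0 : ℝ), v ^ 2 * Real.exp (-κ * v ^ 2) = √Real.pi / (4 * (κ * √κ)) := by
  have h := integral_rpow_mul_exp_neg_mul_rpow (p := 2) (q := 2) two_pos (by norm_num) hκ
  have hG : Real.Gamma ((2 + 1) / 2) = √Real.pi / 2 := by
    rw [show ((2 : ℝ) + 1) / 2 = 1 / 2 + 1 by norm_num, Real.Gamma_add_one (by norm_num),
      Real.Gamma_one_half_eq]
    ring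
  simp only [Real.rpow_two] at h
  rw [h, hG, show (-(2 + 1) / 2 : ℝ) = -(1 + 1 / 2) by norm_num, Real.rpow_neg hκ.le,
    Real.rpow_add hκ, Real.rpow_one, ← Real.sqrt_eq_rpow]
  field_simp
  norm_num

lemma div_cutPoint_eq {a b : ℝ} (ha : 0 < a) (hab : a < b) (s : ℝ) :
    a * (cutPoint a b s)⁻¹ = (1 + (b - a) / a * (s ^ 2 / (1 + s ^ 2)))⁻¹ := by
  have hb := ha.trans hab
  have h1 : a + b * s ^ 2 ≠ 0 := by positivity
  have h2 : 1 + (b - a) / a * (s ^ 2 / (1 + s ^ 2)) = (a + b * s ^ 2) / (a * (1 + s ^ 2)) := by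
    field_simp; ring
  rw [h2, cutPoint, inv_div, inv_div]
  field_simp

lemma tendsto_cutPoint {a b : ℝ} (hab : a < b) :
    Tendsto (cutPoint a b) (𝓝[>] 0) (𝓝[Icc a b] a) := by
  refine tendsto_nhdsWithin_iff.2 ⟨?_, ?_⟩
  · have := (continuous_cutPoint a b).tendsto 0
    have h0 : cutPoint a b 0 = a := by simp [cutPoint]
    rw [h0] at this
    exact this.mono_left nhdsWithin_le_nhds
  · filter_upwards [self_mem_nhdsWithin] with s hs using cutPoint_mem_Icc hab hs

lemma sqrt_div_mul_sqrt {a b : ℝ} (ha : 0 < a) (hab : a < b) :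
    √((b - a) / a) * √(a * (b - a)) = b - a := by
  have h : 0 < b - a := sub_pos.2 hab
  rw [← Real.sqrt_mul (by positivity), show (b - a) / a * (a * (b - a)) = (b - a) ^ 2 by field_simp,
    Real.sqrt_sq h.le]

/-- Moments of the semicircle weight against a continuous density. -/
lemma tendsto_cutIntegral_pow {a b : ℝ} (ha : 0 < a) (hab : a < b) {g : ℝ → ℝ}
    (hg : ContinuousOn g (Icc a b)) :
    Tendsto (fun n : ℕ => √(n : ℝ) ^ 3 * (a ^ n * cutIntegral a b (fun t => g t * t⁻¹ ^ n))) atTop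
      (𝓝 (g a * (√Real.pi / 2 * (a * √(a * (b - a)))))) := by
  obtain ⟨C, hC⟩ := isCompact_Icc.exists_bound_of_continuousOn hg
  have hC0 : 0 ≤ C := (norm_nonneg _).trans (hC a ⟨le_rfl, hab.le⟩)
  have hd : 0 < b - a := sub_pos.2 hab
  have hκ : 0 < (b - a) / a := by positivity
  have hone : Continuous fun s : ℝ => 2 * (b - a) ^ 2 / (1 + s ^ 2) :=
    Continuous.div (by fun_prop) (by fun_prop) fun s => by positivity
  have hL : Tendsto (fun s => 2 * (b - a) ^ 2 / (1 + s ^ 2) * g (cutPoint a b s)) (𝓝[>] 0)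
      (𝓝 (2 * (b - a) ^ 2 * g a)) := by
    have h1 : Tendsto (fun s : ℝ => 2 * (b - a) ^ 2 / (1 + s ^ 2)) (𝓝[>] 0)
        (𝓝 (2 * (b - a) ^ 2)) := by
      have := hone.tendsto 0
      norm_num at this
      exact this.mono_left nhdsWithin_le_nhds
    exact h1.mul (Tendsto.comp (hg a ⟨le_rfl, hab.le⟩) (tendsto_cutPoint hab))
  have key := tendsto_laplace (C := 2 * (b - a) ^ 2 * C)
    (h := fun s => 2 * (b - a) ^ 2 / (1 + s ^ 2) * g (cutPoint a b s)) hκ (hone.continuousOn.mul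
    (hg.comp (continuous_cutPoint a b).continuousOn fun s hs => cutPoint_mem_Icc hab hs)) ?_ hL
    le_rfl
  · rw [mul_one, integral_sq_mul_exp_neg_mul_sq hκ] at key
    convert! key using 2
    · rename_i n
      simp only [cutIntegral]
      rw [← integral_const_mul]
      congr 1
      refine setIntegral_congr_fun measurableSet_Ioi fun s _ => ?_
      have h1 : (1 + s ^ 2 : ℝ) ≠ 0 := by positivity
      rw [← inv_pow, ← div_cutPoint_eq ha hab, cutWeight, mul_pow]
      field_simp
    · have hs := sqrt_div_mul_sqrt ha hab
      have hs0 : 0 < √((b - a) / a) := Real.sqrt_pos.2 hκ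
      rw [show √(a * (b - a)) = (b - a) / √((b - a) / a) by rw [eq_div_iff hs0.ne', mul_comm, hs]]
      field_simp
      norm_num
  · intro s hs
    rw [abs_mul, abs_of_nonneg (by positivity)]
    have h1 : 2 * (b - a) ^ 2 / (1 + s ^ 2) ≤ 2 * (b - a) ^ 2 :=
      div_le_self (by positivity) (by nlinarith)
    exact mul_le_mul h1 (hC _ (cutPoint_mem_Icc hab hs)) (abs_nonneg _) (by positivity)

/-- Moments of the semicircle weight against a density with a simple pole at the left end. -/
lemma tendsto_cutIntegral_pow_div {a b : ℝ} (ha : 0 < a) (hab : a < b) {g : ℝ → ℝ}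
    (hg : ContinuousOn g (Icc a b)) :
    Tendsto (fun n : ℕ => √(n : ℝ) *
      (a ^ n * cutIntegral a b (fun t => g t * t⁻¹ ^ n / (t - a)))) atTop
      (𝓝 (g a * (√Real.pi * √(a * (b - a))))) := by
  obtain ⟨C, hC⟩ := isCompact_Icc.exists_bound_of_continuousOn hg
  have hd : 0 < b - a := sub_pos.2 hab
  have hκ : 0 < (b - a) / a := by positivity
  have hL : Tendsto (fun s => 2 * (b - a) * g (cutPoint a b s)) (𝓝[>] 0)
      (𝓝 (2 * (b - a) * g a)) :=
    (Tendsto.comp (hg a ⟨le_rfl, hab.le⟩) (tendsto_cutPoint hab)).const_mul _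
  have key := tendsto_laplace (C := 2 * (b - a) * C)
    (h := fun s => 2 * (b - a) * g (cutPoint a b s)) hκ ((continuousOn_const (c := 2 * (b - a))).mul
    (hg.comp (continuous_cutPoint a b).continuousOn fun s hs => cutPoint_mem_Icc hab hs)) ?_ hL
    zero_le_one
  · simp only [mul_zero, zero_add, pow_one, pow_zero, one_mul, integral_gaussian_Ioi] at key
    convert! key using 2
    · rename_i n
      simp only [cutIntegral]
      rw [← integral_const_mul]
      congr 1
      refine setIntegral_congr_fun measurableSet_Ioi fun s hs => ?_
      have h1 : (1 + s ^ 2 : ℝ) ≠ 0 := by positivity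
      have hs' : s ≠ 0 := (show 0 < s from hs).ne'
      have h2 : cutPoint a b s - a = (b - a) * s ^ 2 / (1 + s ^ 2) := by
        unfold cutPoint; field_simp; ring
      rw [← inv_pow, ← div_cutPoint_eq ha hab, cutWeight, mul_pow]
      rw [h2]
      field_simp
    · have hs := sqrt_div_mul_sqrt ha hab
      have hs0 : 0 < √((b - a) / a) := Real.sqrt_pos.2 hκ
      rw [show √(a * (b - a)) = (b - a) / √((b - a) / a) by rw [eq_div_iff hs0.ne', mul_comm, hs],
        Real.sqrt_div Real.pi_pos.le]
      field_simp
  · intro s hs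
    rw [abs_mul, abs_of_nonneg (by positivity)]
    exact mul_le_mul_of_nonneg_left (hC _ (cutPoint_mem_Icc hab hs)) (by positivity)

/-! ### Division by the zeros of `N` -/

/-- Let `N` be a quadratic polynomial plus `d y √((a - y) (b - y))`.  Dividing out three linear
factors destroys the polynomial and leaves a Cauchy integral over the cut, apart from the polar part
at `ζ₃`.  The bound near the negative nodes encodes that `N` vanishes at both (twice if they
coincide). -/
lemma division_formula {a b d α₂ α₁ α₀ ζ₁ ζ₂ ζ₃ : ℝ} (ha : 0 < a) (hab : a < b)
    (hζ₁ : ζ₁ < 0) (hζ₂ : ζ₂ < 0) (hζ₃ : 0 < ζ₃) (hζ₃a : ζ₃ ≤ a)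
    {N K : ℝ → ℝ} (hN : ∀ y ≤ a, N y = α₂ * y ^ 2 + α₁ * y + α₀ + d * y * √((a - y) * (b - y)))
    (hK : Continuous K) (hNK : ∀ y < 0, |N y| ≤ |y - ζ₁| * |y - ζ₂| * K y)
    {y : ℝ} (hy : 0 < y) (hya : y < a) :
    N y = (y - ζ₁) * (y - ζ₂) * (N ζ₃ / ((ζ₃ - ζ₁) * (ζ₃ - ζ₂)) -
      (y - ζ₃) * (d / Real.pi) *
        cutIntegral a b (fun t => t * ((t - ζ₁)⁻¹ * (t - ζ₂)⁻¹) / (t - y) / (t - ζ₃))) := by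
  have hpi := Real.pi_pos.ne'
  set k := d / Real.pi with hk
  have hkd : d = k * Real.pi := by rw [hk]; field_simp
  have hζ₁a : ζ₁ < a := hζ₁.trans ha
  have hζ₂a : ζ₂ < a := hζ₂.trans ha
  -- `N` is a quadratic polynomial minus a Cauchy integral
  obtain ⟨β₂, β₁, β₀, hQ⟩ : ∃ β₂ β₁ β₀ : ℝ, ∀ y ≤ a, N y = β₂ * y ^ 2 + β₁ * y + β₀ -
      k * cutIntegral a b (fun t => t / (t - y)) := by
    refine ⟨α₂ - d, α₁ + d * ((a + b) / 2), α₀ + k * cutIntegral a b (fun _ => 1), fun y hy => ?_⟩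
    rw [hN y hy, cutIntegral_id_div hab hy, (integral_cutWeight_inv hab hy).2, hkd]
    ring
  have hc0 : ContinuousOn (fun t : ℝ => t) (Icc a b) := continuousOn_id
  have hc1 := continuousOn_div_sub hζ₁a hc0
  have hc2 := continuousOn_div_sub hζ₂a hc1
  -- first division
  have hNζ₁ : N ζ₁ = 0 := by simpa using hNK ζ₁ hζ₁
  set E₁ : ℝ → ℝ := fun y => β₂ * (y + ζ₁) + β₁ -
    k * cutIntegral a b (fun t => t / (t - ζ₁) / (t - y)) with hE₁
  have hdiv₁ : ∀ y ≤ a, N y = (y - ζ₁) * E₁ y := by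
    intro y hy
    have h1 := cutIntegral_sub hab hy hζ₁a hc0
    have h2 := hQ y hy
    have h3 := hQ ζ₁ hζ₁a.le
    rw [hNζ₁] at h3
    simp only [hE₁]
    linear_combination h2 - h3 - k * h1
  set E₂ : ℝ → ℝ := fun y => β₂ - k * cutIntegral a b (fun t => t / (t - ζ₁) / (t - ζ₂) / (t - y))
    with hE₂
  have hdiv₂' : ∀ y ≤ a, E₁ y - E₁ ζ₂ = (y - ζ₂) * E₂ y := by
    intro y hy
    have h1 := cutIntegral_sub hab hy hζ₂a hc1
    simp only [hE₁, hE₂]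
    linear_combination - k * h1
  -- `E₂` is bounded on the negative axis, hence `E₁` is continuous at `ζ₂`; so `E₁ ζ₂ = 0` also
  -- when `ζ₁ = ζ₂`
  have hE₂b : ∀ y < 0, |E₂ y| ≤
      |β₂| + |k| * cutIntegral a b (fun t => t / (t - ζ₁) / (t - ζ₂) / (t - 0)) := by
    intro y hy
    have hpos : ∀ s ∈ Ioi (0 : ℝ), 0 ≤ cutWeight a b s * (cutPoint a b s / (cutPoint a b s - ζ₁) /
        (cutPoint a b s - ζ₂) / (cutPoint a b s - y)) := by
      intro s hs
      have h := lt_cutPoint hab hs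
      have h0 := ha.trans h
      have h1 : 0 < cutPoint a b s - ζ₁ := by linarith
      have h2 : 0 < cutPoint a b s - ζ₂ := by linarith
      have h3 : 0 < cutPoint a b s - y := by linarith
      exact mul_nonneg (cutWeight_nonneg _ _ _) (by positivity)
    have hle : cutIntegral a b (fun t => t / (t - ζ₁) / (t - ζ₂) / (t - y)) ≤
        cutIntegral a b (fun t => t / (t - ζ₁) / (t - ζ₂) / (t - 0)) := by
      refine setIntegral_mono_on (integrableOn_cut hab (hy.trans ha).le hc2)
        (integrableOn_cut hab ha.le hc2) measurableSet_Ioi fun s hs => ?_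
      have h := lt_cutPoint hab hs
      have h0 := ha.trans h
      have h1 : 0 < cutPoint a b s - ζ₁ := by linarith
      have h2 : 0 < cutPoint a b s - ζ₂ := by linarith
      refine mul_le_mul_of_nonneg_left ?_ (cutWeight_nonneg _ _ _)
      refine div_le_div_of_nonneg_left (by positivity) (by linarith) (by linarith)
    have h0 : 0 ≤ cutIntegral a b (fun t => t / (t - ζ₁) / (t - ζ₂) / (t - y)) :=
      setIntegral_nonneg measurableSet_Ioi hpos
    calc |E₂ y| ≤ |β₂| + |k * cutIntegral a b (fun t => t / (t - ζ₁) / (t - ζ₂) / (t - y))| :=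
          abs_sub _ _
      _ ≤ _ := by rw [abs_mul, abs_of_nonneg h0]; gcongr
  have hE₁ζ₂ : E₁ ζ₂ = 0 := by
    set B := |β₂| + |k| * cutIntegral a b (fun t => t / (t - ζ₁) / (t - ζ₂) / (t - 0))
    have hle : ∀ y < 0, y ≠ ζ₁ → |E₁ ζ₂| ≤ |y - ζ₂| * (K y + B) := by
      intro y hy hne
      have h1 : |E₁ y| ≤ |y - ζ₂| * K y := by
        have h := hNK y hy
        rw [hdiv₁ y (hy.trans ha).le, abs_mul, mul_assoc] at h
        exact le_of_mul_le_mul_left h (abs_pos.2 (sub_ne_zero.2 hne))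
      have h2 := hdiv₂' y (hy.trans ha).le
      calc |E₁ ζ₂| = |E₁ y - (y - ζ₂) * E₂ y| := by rw [← h2]; ring_nf
        _ ≤ |E₁ y| + |(y - ζ₂) * E₂ y| := abs_sub _ _
        _ ≤ |y - ζ₂| * K y + |y - ζ₂| * B := by
            rw [abs_mul]
            gcongr
            exact hE₂b y hy
        _ = _ := by ring
    have hlim : Tendsto (fun y => |y - ζ₂| * (K y + B)) (𝓝[>] ζ₂) (𝓝 (|ζ₂ - ζ₂| * (K ζ₂ + B))) :=
      (Continuous.tendsto (by fun_prop) ζ₂).mono_left nhdsWithin_le_nhds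
    rw [sub_self, abs_zero, zero_mul] at hlim
    have hev : ∀ᶠ y in 𝓝[>] ζ₂, y < 0 ∧ y ≠ ζ₁ := by
      have h1 : ∀ᶠ y in 𝓝[>] ζ₂, y < 0 := mem_nhdsWithin_of_mem_nhds (Iio_mem_nhds hζ₂)
      have h2 : ∀ᶠ y in 𝓝[>] ζ₂, y ≠ ζ₁ := by
        rcases le_or_gt ζ₁ ζ₂ with h | h
        · filter_upwards [self_mem_nhdsWithin] with y hy using (h.trans_lt hy).ne'
        · exact mem_nhdsWithin_of_mem_nhds (isOpen_ne.mem_nhds h.ne)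
      exact h1.and h2
    have := le_of_tendsto_of_tendsto tendsto_const_nhds hlim
      (hev.mono fun y hy => hle y hy.1 hy.2)
    exact abs_nonpos_iff.1 this
  have hdiv₂ : ∀ y ≤ a, N y = (y - ζ₁) * (y - ζ₂) * E₂ y := by
    intro y hy
    have := hdiv₂' y hy
    rw [hE₁ζ₂, sub_zero] at this
    rw [hdiv₁ y hy, this]; ring
  -- the polar part
  have hE₂ζ₃ : N ζ₃ / ((ζ₃ - ζ₁) * (ζ₃ - ζ₂)) = E₂ ζ₃ := by
    have h1 : ζ₃ - ζ₁ ≠ 0 := by linarith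
    have h2 : ζ₃ - ζ₂ ≠ 0 := by linarith
    rw [hdiv₂ ζ₃ hζ₃a]
    field_simp
  have h3 := cutIntegral_sub hab hζ₃a hya hc2
  rw [hdiv₂ y hya.le, hE₂ζ₃]
  have h4 : (fun t => t * ((t - ζ₁)⁻¹ * (t - ζ₂)⁻¹) / (t - y) / (t - ζ₃)) =
      fun t => t / (t - ζ₁) / (t - ζ₂) / (t - y) / (t - ζ₃) := by
    funext t; simp only [div_eq_mul_inv]; ring
  rw [h4]
  simp only [hE₂]
  linear_combination (y - ζ₁) * (y - ζ₂) * k * h3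

/-! ### The functional equation for the generating function -/

variable {p q μh μl : ℝ} {π : ℕ × ℕ → ℝ}

/-- Expectation of `x^i y^j` at the next slot division point, from the state `s`. -/
noncomputable def stepGen (p q μh μl x y : ℝ) (s : ℕ × ℕ) : ℝ :=
  ∑ aH : Bool, ∑ aL : Bool, ∑ dH : Bool, ∑ dL : Bool,
    bern p aH * bern q aL * bern μh dH * bern μl dL *
      (x ^ (slotStep s aH aL dH dL).1 * y ^ (slotStep s aH aL dH dL).2)

/-- Joint generating function of the queue lengths. -/
noncomputable def jointGen (π : ℕ × ℕ → ℝ) (x y : ℝ) : ℝ := ∑' s, π s * (x ^ s.1 * y ^ s.2)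

/-- Generating function of the low-priority queue on the event of no high-priority customer. -/
noncomputable def boundaryGen (π : ℕ × ℕ → ℝ) (y : ℝ) : ℝ := ∑' j : ℕ, π (0, j) * y ^ j

lemma hasSum_transProb (p q μh μl x y : ℝ) (s : ℕ × ℕ) :
    HasSum (fun t => transProb p q μh μl s t * (x ^ t.1 * y ^ t.2)) (stepGen p q μh μl x y s) := by
  unfold transProb stepGen
  simp only [Finset.sum_mul]
  refine hasSum_sum fun aH _ => hasSum_sum fun aL _ => hasSum_sum fun dH _ =>
    hasSum_sum fun dL _ => ?_
  have h := hasSum_single (slotStep s aH aL dH dL) (f := fun t : ℕ × ℕ =>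
    (if slotStep s aH aL dH dL = t then bern p aH * bern q aL * bern μh dH * bern μl dL else 0) *
      (x ^ t.1 * y ^ t.2)) (fun t ht => by simp [Ne.symm ht])
  simpa using h

lemma transProb_nonneg (hp : 0 ≤ p) (hp1 : p ≤ 1) (hq : 0 ≤ q) (hq1 : q ≤ 1) (hh : 0 ≤ μh)
    (hh1 : μh ≤ 1) (hl : 0 ≤ μl) (hl1 : μl ≤ 1) (s t : ℕ × ℕ) : 0 ≤ transProb p q μh μl s t := by
  have hb : ∀ r : ℝ, 0 ≤ r → r ≤ 1 → ∀ b, 0 ≤ bern r b := by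
    intro r h0 h1 b
    cases b <;> simp [bern, h0, h1]
  unfold transProb
  refine Finset.sum_nonneg fun aH _ => Finset.sum_nonneg fun aL _ => Finset.sum_nonneg fun dH _ =>
    Finset.sum_nonneg fun dL _ => ?_
  split_ifs
  · have h1 := hb p hp hp1 aH
    have h2 := hb q hq hq1 aL
    have h3 := hb μh hh hh1 dH
    have h4 := hb μl hl hl1 dL
    positivity
  · exact le_rfl

lemma monomial_mem {x y : ℝ} (hx : 0 ≤ x) (hx1 : x ≤ 1) (hy : 0 ≤ y) (hy1 : y ≤ 1) (s : ℕ × ℕ) :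
    0 ≤ x ^ s.1 * y ^ s.2 ∧ x ^ s.1 * y ^ s.2 ≤ 1 :=
  ⟨by positivity, mul_le_one₀ (pow_le_one₀ hx hx1) (by positivity) (pow_le_one₀ hy hy1)⟩

lemma IsStationary.summable_jointGen (hπ : IsStationary p q μh μl π) {x y : ℝ} (hx : 0 ≤ x)
    (hx1 : x ≤ 1) (hy : 0 ≤ y) (hy1 : y ≤ 1) : Summable fun s => π s * (x ^ s.1 * y ^ s.2) := by
  refine Summable.of_nonneg_of_le (fun s => ?_) (fun s => ?_) hπ.hasSum_one.summable
  · exact mul_nonneg (hπ.nonneg s) (monomial_mem hx hx1 hy hy1 s).1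
  · exact mul_le_of_le_one_right (hπ.nonneg s) (monomial_mem hx hx1 hy hy1 s).2

lemma zero_prodMk_injective : Function.Injective fun j : ℕ => ((0, j) : ℕ × ℕ) :=
  fun _ _ h => (Prod.mk.inj h).2

lemma IsStationary.summable_boundary (hπ : IsStationary p q μh μl π) :
    Summable fun j : ℕ => π (0, j) :=
  hπ.hasSum_one.summable.comp_injective zero_prodMk_injective

lemma IsStationary.summable_boundaryGen (hπ : IsStationary p q μh μl π) {y : ℝ}
    (hy : 0 ≤ y) (hy1 : y ≤ 1) : Summable fun j : ℕ => π (0, j) * y ^ j := by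
  refine Summable.of_nonneg_of_le (fun s => mul_nonneg (hπ.nonneg _) (by positivity)) (fun s => ?_)
    hπ.summable_boundary
  exact mul_le_of_le_one_right (hπ.nonneg _) (pow_le_one₀ hy hy1)

/-- Stationarity, summed against `x^i y^j`. -/
lemma IsStationary.hasSum_stepGen (hπ : IsStationary p q μh μl π)
    (hT : ∀ s t, 0 ≤ transProb p q μh μl s t) {x y : ℝ} (hx : 0 ≤ x) (hx1 : x ≤ 1) (hy : 0 ≤ y)
    (hy1 : y ≤ 1) : HasSum (fun s => π s * stepGen p q μh μl x y s) (jointGen π x y) := by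
  have h1 : ∀ t : ℕ × ℕ, HasSum (fun s => π s * transProb p q μh μl s t * (x ^ t.1 * y ^ t.2))
      (π t * (x ^ t.1 * y ^ t.2)) := fun t => (hπ.balance t).mul_right _
  have hs : Summable (Function.uncurry fun t s : ℕ × ℕ =>
      π s * transProb p q μh μl s t * (x ^ t.1 * y ^ t.2)) := by
    refine (summable_prod_of_nonneg fun ts => ?_).2 ⟨fun t => (h1 t).summable, ?_⟩
    · exact mul_nonneg (mul_nonneg (hπ.nonneg _) (hT _ _)) (monomial_mem hx hx1 hy hy1 _).1
    · refine (hπ.summable_jointGen hx hx1 hy hy1).congr fun t => ?_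
      exact ((h1 t).tsum_eq).symm
  have h2 : ∀ s : ℕ × ℕ, HasSum (fun t => π s * transProb p q μh μl s t * (x ^ t.1 * y ^ t.2))
      (π s * stepGen p q μh μl x y s) := fun s => by
    simpa only [mul_assoc] using (hasSum_transProb p q μh μl x y s).mul_left (π s)
  have h3 : HasSum (fun ts : (ℕ × ℕ) × (ℕ × ℕ) =>
      π ts.2 * transProb p q μh μl ts.2 ts.1 * (x ^ ts.1.1 * y ^ ts.1.2)) (jointGen π x y) := by
    have := hs.hasSum.prod_fiberwise (fun t => h1 t)
    rw [jointGen, this.tsum_eq]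
    exact hs.hasSum
  exact ((Equiv.prodComm _ _).hasSum_iff.2 h3).prod_fiberwise fun s => h2 s

/-- The functional equation between the joint generating function and its boundary values. -/
lemma IsStationary.functional_equation (hπ : IsStationary p q μh μl π)
    (hT : ∀ s t, 0 ≤ transProb p q μh μl s t) {x y : ℝ} (hx : 0 ≤ x) (hx1 : x ≤ 1) (hy : 0 ≤ y)
    (hy1 : y ≤ 1) :
    x * y * jointGen π x y =
      y * (q * y + (1 - q)) * (p * x + (1 - p)) * (μh + (1 - μh) * x) * jointGen π x y +
      (q * y + (1 - q)) * (1 - p) * (x * (μl + (1 - μl) * y) - y * (μh + (1 - μh) * x)) *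
        boundaryGen π y +
      x * (1 - p) * (1 - q) * μl * (y - 1) * π (0, 0) := by
  have hJ := (hπ.summable_jointGen hx hx1 hy hy1).hasSum
  have hB : HasSum (fun s : ℕ × ℕ => if s.1 = 0 then π s * y ^ s.2 else 0) (boundaryGen π y) := by
    rw [← zero_prodMk_injective.hasSum_iff]
    · simpa [Function.comp_def, boundaryGen] using (hπ.summable_boundaryGen hy hy1).hasSum
    · rintro ⟨i, j⟩ h
      rw [if_neg]
      rintro rfl
      exact h ⟨j, rfl⟩
  have h0 : HasSum (fun s : ℕ × ℕ => if s = (0, 0) then π (0, 0) else 0) (π (0, 0)) :=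
    hasSum_ite_eq _ _
  have hL := (hπ.hasSum_stepGen hT hx hx1 hy hy1).mul_left (x * y)
  have hR := ((hJ.mul_left (y * (q * y + (1 - q)) * (p * x + (1 - p)) * (μh + (1 - μh) * x))).add
    (hB.mul_left ((q * y + (1 - q)) * (1 - p) *
      (x * (μl + (1 - μl) * y) - y * (μh + (1 - μh) * x))))).add
    (h0.mul_left (x * (1 - p) * (1 - q) * μl * (y - 1)))
  refine hL.unique ?_
  convert! hR using 1
  funext s
  obtain ⟨i, j⟩ := s
  rcases i with _ | i
  · rcases j with _ | j
    · simp [stepGen, slotStep, bern]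
      ring
    · simp [stepGen, slotStep, bern, pow_succ]
      ring
  · simp [stepGen, slotStep, bern, pow_succ]
    ring

/-! ### The kernel method -/

/-- The discriminant of the kernel, as a quadratic in `w = q y + 1 - q`. -/
noncomputable def kernelDisc (p q μh y : ℝ) : ℝ :=
  1 - 2 * (p * μh + (1 - p) * (1 - μh)) * (q * y + (1 - q)) +
    ((1 - p) - μh) ^ 2 * (q * y + (1 - q)) ^ 2

/-- The quadratic with roots `1 / η₁` and `1 / η₂`. -/
noncomputable def etaPoly (p q μh μl y : ℝ) : ℝ :=
  (1 - p) * (1 - q) * μl ^ 2 - μl * etaB p q μh μl * y - (μh - (1 - p) * μl) * (1 - μl) * q * y ^ 2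

/-- The product of `F + y √Δ` and its conjugate `F - y √Δ`. -/
lemma F_sq_sub (p q μh μl y : ℝ) :
    F p q μh μl y ^ 2 - y ^ 2 * kernelDisc p q μh y =
      4 * (1 - p) * (q * y + (1 - q)) * (1 - y) * etaPoly p q μh μl y := by
  unfold F kernelDisc etaPoly etaB
  ring

lemma kernelDisc_sq (p q μh y : ℝ) : kernelDisc p q μh y =
    (1 + ((1 - p) - μh) * (q * y + (1 - q))) ^ 2 -
      4 * (1 - p) * (1 - μh) * (q * y + (1 - q)) := by
  unfold kernelDisc
  ring

/-- A root `u` of a convex quadratic that lies to the right of a point `v` where the quadratic is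
negative is the larger root; this fixes the sign of the square root of the discriminant. -/
lemma root_eq_of_neg {A B C u v : ℝ} (hA : 0 < A) (hu : A * u ^ 2 - B * u + C = 0)
    (hv : A * v ^ 2 - B * v + C < 0) (hvu : v < u) : √(B ^ 2 - 4 * A * C) = 2 * A * u - B := by
  have h1 : 0 < (u - v) * (A * (u + v) - B) := by nlinarith
  have h2 : 0 < A * (u + v) - B := by
    by_contra h
    nlinarith
  rw [show B ^ 2 - 4 * A * C = (2 * A * u - B) ^ 2 by linear_combination (- 4 * A) * hu,
    Real.sqrt_sq (by nlinarith)]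

/-- On the root of the kernel the joint generating function drops out of the functional equation. -/
lemma IsStationary.boundaryGen_mul (hπ : IsStationary p q μh μl π)
    (hT : ∀ s t, 0 ≤ transProb p q μh μl s t) (hp : 0 < p) (hp1 : p < 1) (hq : 0 < q) (hq1 : q < 1)
    (hh : 0 < μh) {y : ℝ} (hy : 0 < y) (hy1 : y < 1) :
    boundaryGen π y * (F p q μh μl y - y * √(kernelDisc p q μh y)) =
      2 * (1 - p) * (1 - q) * μl * π (0, 0) * (1 - y) := by
  set w := q * y + (1 - q) with hw
  have hw0 : 0 < w := by nlinarith
  have hw1 : w < 1 := by nlinarith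
  -- the root of the kernel in `(0, 1)`
  obtain ⟨x, ⟨hx0, hx1⟩, hx⟩ : ∃ x ∈ Ioo (0 : ℝ) 1,
      x - w * (p * x + (1 - p)) * (μh + (1 - μh) * x) = 0 := by
    have hc : ContinuousOn (fun x : ℝ => x - w * (p * x + (1 - p)) * (μh + (1 - μh) * x))
        (Icc 0 1) := by fun_prop
    refine intermediate_value_Ioo zero_le_one hc ⟨?_, ?_⟩
    · have : 0 < w * (1 - p) * μh := mul_pos (mul_pos hw0 (by linarith)) hh
      linarith
    · linarith
  -- `u` is rational in `x` and, like `x`, a root of a quadratic with discriminant `kernelDisc`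
  set u := (p * x + (1 - p))⁻¹ with hu
  have hden : 0 < p * x + (1 - p) := by nlinarith
  have hu1 : 1 < u := by
    rw [hu]
    exact (one_lt_inv₀ hden).2 (by nlinarith)
  clear_value u w
  have hux : u * (p * x + (1 - p)) = 1 := by rw [hu]; exact inv_mul_cancel₀ hden.ne'
  have hux' : u * x = w * (μh + (1 - μh) * x) := by
    have : x = w * (p * x + (1 - p)) * (μh + (1 - μh) * x) := by linarith
    linear_combination u * this + w * (μh + (1 - μh) * x) * hux
  have hquad : (1 - p) * u ^ 2 - (1 + ((1 - p) - μh) * w) * u + (1 - μh) * w = 0 := by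
    have : x * ((1 - p) * u ^ 2 - (1 + ((1 - p) - μh) * w) * u + (1 - μh) * w) = 0 := by
      linear_combination (x * u - (1 - μh) * w * x) * hux - p * u * x * hux'
    exact (mul_eq_zero.1 this).resolve_left hx0.ne'
  -- at `1` the quadratic is `-p (1 - w) < 0`, so that `u > 1` is its larger root
  have hroot := root_eq_of_neg (v := 1) (by linarith : 0 < 1 - p) hquad (by nlinarith) hu1
  have hdisc : √(kernelDisc p q μh y) = 2 * (1 - p) * u - (1 + ((1 - p) - μh) * w) := by
    rw [kernelDisc_sq, ← hw, ← hroot]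
    ring_nf
  have hfe := hπ.functional_equation hT hx0.le hx1.le hy.le hy1.le
  rw [← hw] at hfe
  have hfe' : boundaryGen π y * (w * (μl + (1 - μl) * y) - y * u) =
      (1 - q) * μl * (1 - y) * π (0, 0) := by
    have hx' : x * (1 - p) ≠ 0 := mul_ne_zero hx0.ne' (by linarith)
    refine mul_left_cancel₀ hx' ?_
    linear_combination - hfe + y * jointGen π x y * hx - (1 - p) * y * boundaryGen π y * hux'
  rw [hdisc, show F p q μh μl y - y * (2 * (1 - p) * u - (1 + ((1 - p) - μh) * w)) =
    2 * (1 - p) * (w * (μl + (1 - μl) * y) - y * u) by rw [hw]; unfold F; ring]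
  linear_combination 2 * (1 - p) * hfe'

/-- The generating function `∑ⱼ π(0,j) yʲ`, up to normalization: both sides of `boundaryGen_mul` are
multiplied by the conjugate factor and the common factor `1 - y` is cancelled. -/
lemma IsStationary.boundaryGen_mul_etaPoly (hπ : IsStationary p q μh μl π)
    (hT : ∀ s t, 0 ≤ transProb p q μh μl s t) (hp : 0 < p) (hp1 : p < 1) (hq : 0 < q) (hq1 : q < 1)
    (hh : 0 < μh) {y : ℝ} (hy : 0 < y) (hy1 : y < 1)
    (hD : 0 ≤ kernelDisc p q μh y) :
    boundaryGen π y * (2 * (q * y + (1 - q)) * etaPoly p q μh μl y) =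
      (1 - q) * μl * π (0, 0) * (F p q μh μl y + y * √(kernelDisc p q μh y)) := by
  have h := hπ.boundaryGen_mul hT hp hp1 hq hq1 hh hy hy1
  have hs := Real.sq_sqrt hD
  have hF := F_sq_sub p q μh μl y
  have h2 : 2 * (1 - p) * (1 - y) ≠ 0 := by
    have : 0 < 1 - p := by linarith
    have : 0 < 1 - y := by linarith
    positivity
  refine mul_left_cancel₀ h2 ?_
  linear_combination (F p q μh μl y + y * √(kernelDisc p q μh y)) * h - boundaryGen π y * hF +
    boundaryGen π y * y ^ 2 * hs

/-! ### Normalization -/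

lemma tendsto_tsum_pow_one {ι : Type*} {a : ι → ℝ} (ha : ∀ i, 0 ≤ a i) (hs : Summable a)
    (k : ι → ℕ) : Tendsto (fun x : ℝ => ∑' i, a i * x ^ k i) (𝓝[<] 1) (𝓝 (∑' i, a i)) := by
  refine tendsto_tsum_of_dominated_convergence hs (fun i => ?_) ?_
  · have h : Continuous fun x : ℝ => a i * x ^ k i := by fun_prop
    simpa using (h.tendsto 1).mono_left nhdsWithin_le_nhds
  · filter_upwards [Ioo_mem_nhdsLT zero_lt_one] with x hx i
    rw [norm_mul, norm_pow, Real.norm_of_nonneg (ha i), Real.norm_of_nonneg hx.1.le]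
    exact mul_le_of_le_one_right (ha i) (pow_le_one₀ hx.1.le hx.2.le)

/-- The probability of no high-priority customer at a slot division point, from the functional
equation at `y = 1`, `x → 1`. -/
lemma IsStationary.boundaryGen_one (hπ : IsStationary p q μh μl π)
    (hT : ∀ s t, 0 ≤ transProb p q μh μl s t) :
    (1 - p) * μh * boundaryGen π 1 = μh - p := by
  have hlim : Tendsto (fun x => ((1 - p) * μh - p * (1 - μh) * x) * jointGen π x 1) (𝓝[<] 1)
      (𝓝 (((1 - p) * μh - p * (1 - μh) * 1) * 1)) := by
    have h1 : Tendsto (fun x => jointGen π x 1) (𝓝[<] 1) (𝓝 1) := by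
      have := tendsto_tsum_pow_one hπ.nonneg hπ.hasSum_one.summable fun s => s.1
      rw [hπ.hasSum_one.tsum_eq] at this
      simpa [jointGen] using this
    have h2 : Continuous fun x : ℝ => (1 - p) * μh - p * (1 - μh) * x := by fun_prop
    exact ((h2.tendsto 1).mono_left nhdsWithin_le_nhds).mul h1
  have heq : ∀ᶠ x in 𝓝[<] (1 : ℝ), ((1 - p) * μh - p * (1 - μh) * x) * jointGen π x 1 =
      (1 - p) * μh * boundaryGen π 1 := by
    filter_upwards [Ioo_mem_nhdsLT zero_lt_one] with x hx
    have h := hπ.functional_equation hT hx.1.le hx.2.le zero_le_one le_rfl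
    refine mul_left_cancel₀ (sub_pos.2 hx.2).ne' ?_
    linear_combination -h
  have := tendsto_nhds_unique (hlim.congr' heq) tendsto_const_nhds
  linear_combination -this

/-- The probability of the empty system. -/
lemma IsStationary.apply_zero (hπ : IsStationary p q μh μl π)
    (hT : ∀ s t, 0 ≤ transProb p q μh μl s t) (hp : 0 < p) (hp1 : p < 1) (hq : 0 < q) (hq1 : q < 1)
    (hh : 0 < μh) (hl : 0 < μl) (hph : p < μh)
    (hD : ∀ y ∈ Ioo (0 : ℝ) 1, 0 ≤ kernelDisc p q μh y) : π (0, 0) = pi00 p q μh μl := by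
  have hB : Tendsto (boundaryGen π) (𝓝[<] 1) (𝓝 (boundaryGen π 1)) := by
    have := tendsto_tsum_pow_one (fun j => hπ.nonneg (0, j)) hπ.summable_boundary fun j => j
    rw [show boundaryGen π 1 = ∑' j, π (0, j) by simp [boundaryGen]]
    exact this
  have hL : Continuous fun y => 2 * (q * y + (1 - q)) * etaPoly p q μh μl y := by
    unfold etaPoly; fun_prop
  have hR : Continuous fun y => (1 - q) * μl * π (0, 0) *
      (F p q μh μl y + y * √(kernelDisc p q μh y)) := by
    unfold F kernelDisc; fun_prop
  have h1 := hB.mul ((hL.tendsto 1).mono_left nhdsWithin_le_nhds)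
  have h2 := (hR.tendsto 1).mono_left (nhdsWithin_le_nhds (s := Iio 1))
  have heq : ∀ᶠ y in 𝓝[<] (1 : ℝ), boundaryGen π y * (2 * (q * y + (1 - q)) * etaPoly p q μh μl y) =
      (1 - q) * μl * π (0, 0) * (F p q μh μl y + y * √(kernelDisc p q μh y)) := by
    filter_upwards [Ioo_mem_nhdsLT zero_lt_one] with y hy
    exact hπ.boundaryGen_mul_etaPoly hT hp hp1 hq hq1 hh hy.1 hy.2 (hD y hy)
  have h3 := tendsto_nhds_unique (h1.congr' heq) h2
  have hF1 : F p q μh μl 1 = μh - p := by unfold F; ring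
  have hD1 : √(kernelDisc p q μh 1) = μh - p := by
    rw [show kernelDisc p q μh 1 = (μh - p) ^ 2 by unfold kernelDisc; ring,
      Real.sqrt_sq (by linarith)]
  have hE1 : etaPoly p q μh μl 1 = μh * μl * (1 - rho p q μh μl) := by
    unfold etaPoly etaB rho; field_simp; ring
  have hb := hπ.boundaryGen_one hT
  rw [hF1, hD1, hE1] at h3
  have hp1' : 1 - p ≠ 0 := by linarith
  have hq1' : 1 - q ≠ 0 := by linarith
  have hne : 2 * (μh - p) * μl ≠ 0 := by
    have : 0 < μh - p := by linarith
    positivity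
  rw [pi00, eq_div_iff (mul_ne_zero hp1' hq1')]
  refine mul_left_cancel₀ hne ?_
  linear_combination -(1 - p) * h3 + 2 * μl * (1 - rho p q μh μl) * hb

/-! ### Branch points and poles -/

/-- Parameters of a stable queue, with `μl ≤ μh`. -/
structure Params (p q μh μl : ℝ) : Prop where
  p_pos : 0 < p
  q_pos : 0 < q
  h_pos : 0 < μh
  l_pos : 0 < μl
  sum_eq : p + q + μh + μl = 1
  le : μl ≤ μh
  rho_lt : rho p q μh μl < 1

namespace Params

variable (P : Params p q μh μl)
include P

lemma p_lt_one : p < 1 := by linarith [P.p_pos, P.q_pos, P.h_pos, P.l_pos, P.sum_eq]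
lemma q_lt_one : q < 1 := by linarith [P.p_pos, P.q_pos, P.h_pos, P.l_pos, P.sum_eq]
lemma h_lt_one : μh < 1 := by linarith [P.p_pos, P.q_pos, P.h_pos, P.l_pos, P.sum_eq]
lemma l_lt_one : μl < 1 := by linarith [P.p_pos, P.q_pos, P.h_pos, P.l_pos, P.sum_eq]

lemma p_lt_h : p < μh := by
  have h := P.rho_lt
  have h1 : 0 < q / μl := div_pos P.q_pos P.l_pos
  unfold rho at h
  exact (div_lt_one P.h_pos).1 (by linarith)

lemma e_pos : 0 < (1 - p) - μh := by linarith [P.q_pos, P.l_pos, P.sum_eq]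

lemma sqrt_pos : 0 < √(p * μh * (1 - p) * (1 - μh)) := by
  have h1 : 0 < 1 - p := sub_pos.2 P.p_lt_one
  have h2 : 0 < 1 - μh := sub_pos.2 P.h_lt_one
  have := P.p_pos
  have := P.h_pos
  positivity

lemma sqrt_sq : √(p * μh * (1 - p) * (1 - μh)) ^ 2 = p * μh * (1 - p) * (1 - μh) :=
  Real.sq_sqrt (Real.sqrt_pos.1 P.sqrt_pos).le

lemma y0_eq : y0 p q μh = (p * μh + (1 - p) * (1 - μh) - 2 * √(p * μh * (1 - p) * (1 - μh)) -
    ((1 - p) - μh) ^ 2 * (1 - q)) / (((1 - p) - μh) ^ 2 * q) := by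
  have h1 := P.e_pos.ne'
  have h2 := P.q_pos.ne'
  rw [y0, show p * μh - (1 - p) * (1 - μh) = -((1 - p) - μh) by ring, neg_sq]
  field_simp

lemma y1_eq : y1 p q μh = (p * μh + (1 - p) * (1 - μh) + 2 * √(p * μh * (1 - p) * (1 - μh)) -
    ((1 - p) - μh) ^ 2 * (1 - q)) / (((1 - p) - μh) ^ 2 * q) := by
  have h1 := P.e_pos.ne'
  have h2 := P.q_pos.ne'
  rw [y1, show p * μh - (1 - p) * (1 - μh) = -((1 - p) - μh) by ring, neg_sq]
  field_simp

lemma y0_lt_y1 : y0 p q μh < y1 p q μh := by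
  have h1 := P.e_pos
  have h2 := P.q_pos
  have h3 := P.sqrt_pos
  rw [P.y0_eq, P.y1_eq]
  gcongr
  linarith

lemma one_lt_y0 : 1 < y0 p q μh := by
  have h1 := P.e_pos
  have h2 := P.q_pos
  have hp := P.p_pos
  have hh := P.h_pos
  have hph := P.p_lt_h
  rw [P.y0_eq, lt_div_iff₀ (by positivity)]
  have hσ : 0 < (p * μh + (1 - p) * (1 - μh) - ((1 - p) - μh) ^ 2) / 2 := by nlinarith
  -- both sides are compared after squaring; the difference of squares is `e² (μh - p)² / 4`
  -- with `e = 1 - p - μh`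
  have h : √(p * μh * (1 - p) * (1 - μh)) <
      (p * μh + (1 - p) * (1 - μh) - ((1 - p) - μh) ^ 2) / 2 := by
    rw [Real.sqrt_lt' hσ]
    have : 0 < ((1 - p) - μh) ^ 2 * (μh - p) ^ 2 := by
      have := sub_pos.2 hph
      positivity
    nlinarith
  linarith

lemma kernelDisc_eq (y : ℝ) : kernelDisc p q μh y =
    (((1 - p) - μh) * q) ^ 2 * ((y0 p q μh - y) * (y1 p q μh - y)) := by
  have h1 := P.e_pos.ne'
  have h2 := P.q_pos.ne'
  rw [P.y0_eq, P.y1_eq, kernelDisc]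
  field_simp
  linear_combination 4 * P.sqrt_sq

lemma kernelDisc_nonneg {y : ℝ} (hy : y ≤ y0 p q μh) : 0 ≤ kernelDisc p q μh y := by
  rw [P.kernelDisc_eq]
  have := P.y0_lt_y1
  exact mul_nonneg (sq_nonneg _) (mul_nonneg (by linarith) (by linarith))

lemma sqrt_kernelDisc {y : ℝ} : √(kernelDisc p q μh y) =
    ((1 - p) - μh) * q * √((y0 p q μh - y) * (y1 p q μh - y)) := by
  rw [P.kernelDisc_eq, Real.sqrt_mul (sq_nonneg _), Real.sqrt_sq (mul_pos P.e_pos P.q_pos).le]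

lemma etaLead_pos : 0 < μh - (1 - p) * μl := by nlinarith [P.le, P.p_pos, P.l_pos]

lemma abs_etaB_lt : |etaB p q μh μl| < √(etaDisc p q μh μl) := by
  refine Real.lt_sqrt_of_sq_lt ?_
  have h1 := P.etaLead_pos
  have h2 := sub_pos.2 P.p_lt_one
  have h3 := sub_pos.2 P.q_lt_one
  have h4 := sub_pos.2 P.l_lt_one
  have h5 := P.q_pos
  have : 0 < 4 * (1 - p) * (1 - q) * (μh - (1 - p) * μl) * (1 - μl) * q := by positivity
  rw [sq_abs, etaDisc]
  linarith

lemma etaDen_pos : 0 < 2 * (1 - p) * (1 - q) * μl := by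
  have h2 := sub_pos.2 P.p_lt_one
  have h3 := sub_pos.2 P.q_lt_one
  have h5 := P.l_pos
  positivity

lemma eta1_pos : 0 < eta1 p q μh μl :=
  div_pos (by linarith [(abs_lt.1 P.abs_etaB_lt).1]) P.etaDen_pos

lemma eta2_neg : eta2 p q μh μl < 0 :=
  div_neg_of_neg_of_pos (by linarith [(abs_lt.1 P.abs_etaB_lt).2]) P.etaDen_pos

lemma etaPoly_eq (y : ℝ) : etaPoly p q μh μl y =
    (1 - p) * (1 - q) * μl ^ 2 * ((1 - eta1 p q μh μl * y) * (1 - eta2 p q μh μl * y)) := by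
  have h2 := (sub_pos.2 P.p_lt_one).ne'
  have h3 := (sub_pos.2 P.q_lt_one).ne'
  have h5 := P.l_pos.ne'
  have hs : √(etaDisc p q μh μl) ^ 2 = etaDisc p q μh μl :=
    Real.sq_sqrt (Real.sqrt_pos.1 ((abs_nonneg _).trans_lt P.abs_etaB_lt)).le
  unfold eta1 eta2 etaPoly
  generalize √(etaDisc p q μh μl) = r at hs ⊢
  rw [etaDisc] at hs
  field_simp
  linear_combination y ^ 2 * hs

/-- Stability puts the pole `1 / η₁` beyond `1`. -/
lemma eta1_lt_one : eta1 p q μh μl < 1 := by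
  have h1 : etaPoly p q μh μl 1 = μh * μl * (1 - rho p q μh μl) := by
    have := P.h_pos
    have := P.l_pos
    unfold etaPoly etaB rho; field_simp; ring
  have h2 : 0 < etaPoly p q μh μl 1 := by
    rw [h1]
    exact mul_pos (mul_pos P.h_pos P.l_pos) (sub_pos.2 P.rho_lt)
  rw [P.etaPoly_eq, mul_one, mul_one] at h2
  have h3 := sub_pos.2 P.p_lt_one
  have h4 := sub_pos.2 P.q_lt_one
  have h5 := P.l_pos
  have h6 := pos_of_mul_pos_right h2 (by positivity)
  have h7 := P.eta2_neg
  by_contra h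
  nlinarith

/-- For `y < 0` the conjugate factor of `N` stays away from zero. -/
lemma conj_lower {y : ℝ} (hy : y < 0) :
    2 * (1 - p) * (1 - q) * μl ≤ F p q μh μl y - y * √(kernelDisc p q μh y) := by
  have hp := P.p_pos
  have hq := P.q_pos
  have hl := P.l_pos
  have h2 := sub_pos.2 P.p_lt_one
  have h3 := sub_pos.2 P.q_lt_one
  have h4 := sub_pos.2 P.l_lt_one
  have hroot : 2 * (1 - p) - (1 + ((1 - p) - μh) * (q * y + (1 - q))) ≤ √(kernelDisc p q μh y) := by
    refine (le_abs_self _).trans (Real.abs_le_sqrt ?_)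
    rw [kernelDisc_sq]
    have : 0 ≤ 4 * (1 - p) * p * (q * (1 - y)) := by
      have : 0 < 1 - y := by linarith
      positivity
    nlinarith
  have h5 : F p q μh μl y - y * (2 * (1 - p) - (1 + ((1 - p) - μh) * (q * y + (1 - q)))) =
      2 * (1 - p) * ((1 - q) * μl) + 2 * (1 - p) * (q * (1 - μl) * y ^ 2 +
        (-y) * (q * (1 - μl) + μl * (1 - q))) := by
    unfold F; ring
  have h6 : 0 ≤ 2 * (1 - p) * (q * (1 - μl) * y ^ 2 + (-y) * (q * (1 - μl) + μl * (1 - q))) := by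
    have : 0 < -y := by linarith
    positivity
  nlinarith

end Params

/-! ### The integral representation of the boundary probabilities -/

lemma coeff_eq_zero_of_hasSum_zero (n : ℕ) : ∀ c : ℕ → ℝ,
    (∀ y ∈ Ioo (0 : ℝ) 1, HasSum (fun n => c n * y ^ n) 0) → c n = 0 := by
  have hzero : ∀ c : ℕ → ℝ, (∀ y ∈ Ioo (0 : ℝ) 1, HasSum (fun n => c n * y ^ n) 0) → c 0 = 0 := by
    intro c hc
    have hs := (hc (1 / 2) (by norm_num)).summable.norm
    have hlim : Tendsto (fun y : ℝ => ∑' n, c n * y ^ n) (𝓝[>] 0) (𝓝 (∑' n, c n * 0 ^ n)) := by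
      refine tendsto_tsum_of_dominated_convergence hs (fun i => ?_) ?_
      · have h : Continuous fun x : ℝ => c i * x ^ i := by fun_prop
        exact (h.tendsto 0).mono_left nhdsWithin_le_nhds
      · filter_upwards [Ioo_mem_nhdsGT (show (0 : ℝ) < 1 / 2 by norm_num)] with x hx i
        rw [norm_mul, norm_mul, norm_pow, norm_pow, Real.norm_of_nonneg hx.1.le,
          Real.norm_of_nonneg (by norm_num : (0 : ℝ) ≤ 1 / 2)]
        gcongr
        · exact hx.1.le
        · exact hx.2.le
    have heq : ∀ᶠ y : ℝ in 𝓝[>] 0, ∑' n, c n * y ^ n = 0 := by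
      filter_upwards [Ioo_mem_nhdsGT zero_lt_one] with y hy using (hc y hy).tsum_eq
    have h := tendsto_nhds_unique (hlim.congr' heq) tendsto_const_nhds
    rw [tsum_eq_single 0 fun n hn => by simp [hn]] at h
    simpa using h
  induction n with
  | zero => exact hzero
  | succ n ih =>
    intro c hc
    refine ih (fun n => c (n + 1)) fun y hy => ?_
    have h := (hasSum_nat_add_iff' 1).2 (hc y hy)
    simp only [Finset.range_one, Finset.sum_singleton, hzero c hc, zero_mul, sub_zero] at h
    have h2 := h.mul_left y⁻¹
    rw [mul_zero] at h2
    have hy0 := hy.1.ne'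
    convert! h2 using 1
    funext n
    field_simp
    rw [pow_succ]; ring

/-- A power series on `(0, 1)` determines its coefficients. -/
lemma coeff_unique {u v : ℕ → ℝ} {f : ℝ → ℝ}
    (hu : ∀ y ∈ Ioo (0 : ℝ) 1, HasSum (fun n => u n * y ^ n) (f y))
    (hv : ∀ y ∈ Ioo (0 : ℝ) 1, HasSum (fun n => v n * y ^ n) (f y)) (n : ℕ) : u n = v n := by
  refine sub_eq_zero.1 (coeff_eq_zero_of_hasSum_zero n (fun n => u n - v n) fun y hy => ?_)
  simpa [sub_mul] using (hu y hy).sub (hv y hy)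

/-- Numerator of the generating function `∑ⱼ π(0,j) yʲ`. -/
noncomputable def numer (p q μh μl y : ℝ) : ℝ :=
  F p q μh μl y + y * √(kernelDisc p q μh y)

/-- Density, relative to the semicircle weight and without the factor `1 / (t - 1 / η₁)`, of the
measure on the cut whose moments appear in `π(0,j)`. -/
noncomputable def cutDensity (p q μh μl t : ℝ) : ℝ :=
  (t - -((1 - q) / q))⁻¹ * (t - (eta2 p q μh μl)⁻¹)⁻¹

/-- The moments on the cut. -/
noncomputable def cutMoment (p q μh μl : ℝ) (n : ℕ) : ℝ :=
  cutIntegral (y0 p q μh) (y1 p q μh)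
    (fun t => cutDensity p q μh μl t * t⁻¹ ^ n / (t - (eta1 p q μh μl)⁻¹))

namespace Params

variable (P : Params p q μh μl)
include P

lemma node_neg : -((1 - q) / q) < 0 :=
  neg_lt_zero.2 (div_pos (sub_pos.2 P.q_lt_one) P.q_pos)

lemma continuousOn_cutDensity :
    ContinuousOn (cutDensity p q μh μl) (Icc (y0 p q μh) (y1 p q μh)) := by
  have h0 := P.one_lt_y0
  have h1 := P.node_neg
  have h2 := inv_lt_zero.2 P.eta2_neg
  refine ContinuousOn.mul ?_ ?_
  · refine ContinuousOn.inv₀ (by fun_prop) fun t ht => ?_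
    exact (by linarith [ht.1] : 0 < t - -((1 - q) / q)).ne'
  · refine ContinuousOn.inv₀ (by fun_prop) fun t ht => ?_
    exact (by linarith [ht.1] : 0 < t - (eta2 p q μh μl)⁻¹).ne'

/-- The numerator vanishes at both negative nodes, to second order if they coincide: it is the
product in `F_sq_sub` divided by the conjugate factor, which is bounded below. -/
lemma numer_bound {y : ℝ} (hy : y < 0) : |numer p q μh μl y| ≤
    |y - -((1 - q) / q)| * |y - (eta2 p q μh μl)⁻¹| *
      (2 * q * μl * (1 - p) * (1 - y) * (1 - eta1 p q μh μl * y) * (-eta2 p q μh μl)) := by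
  have hM := P.conj_lower hy
  have hp := sub_pos.2 P.p_lt_one
  have hq := sub_pos.2 P.q_lt_one
  have hl := P.l_pos
  have hq0 := P.q_pos
  have h0 : 0 < 2 * (1 - p) * (1 - q) * μl := by positivity
  have hη2 := P.eta2_neg
  have hη1 := P.eta1_pos
  have hs := Real.sq_sqrt (P.kernelDisc_nonneg (hy.le.trans (zero_le_one.trans P.one_lt_y0.le)))
  have hprod : numer p q μh μl y * (F p q μh μl y - y * √(kernelDisc p q μh y)) =
      2 * (1 - p) * (1 - q) * μl * ((y - -((1 - q) / q)) * (y - (eta2 p q μh μl)⁻¹) *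
      (2 * q * μl * (1 - p) * (1 - y) * (1 - eta1 p q μh μl * y) * (-eta2 p q μh μl))) := by
    have h := F_sq_sub p q μh μl y
    rw [P.etaPoly_eq] at h
    have e1 : q * (y - -((1 - q) / q)) = q * y + (1 - q) := by
      rw [mul_sub, mul_neg, mul_div_cancel₀ _ hq0.ne']; ring
    have e2 : (-eta2 p q μh μl) * (y - (eta2 p q μh μl)⁻¹) = 1 - eta2 p q μh μl * y := by
      rw [mul_sub, neg_mul, neg_mul, mul_inv_cancel₀ hη2.ne]; ring
    rw [← e1, ← e2] at h
    unfold numer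
    linear_combination h - y ^ 2 * hs
  have h1y : 0 < 1 - y := by linarith
  have h2y : 0 < 1 - eta1 p q μh μl * y := by nlinarith
  have h3y : 0 < -eta2 p q μh μl := by linarith
  have habs := congrArg abs hprod
  rw [abs_mul, abs_of_pos (h0.trans_le hM), abs_mul, abs_of_pos h0, abs_mul, abs_mul,
    abs_of_pos (show 0 < 2 * q * μl * (1 - p) * (1 - y) * (1 - eta1 p q μh μl * y) *
      (-eta2 p q μh μl) by positivity)] at habs
  refine le_of_mul_le_mul_left ?_ h0
  calc 2 * (1 - p) * (1 - q) * μl * |numer p q μh μl y|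
      ≤ |numer p q μh μl y| * (F p q μh μl y - y * √(kernelDisc p q μh y)) := by
        rw [mul_comm]; gcongr
    _ = _ := habs

/-- The exact formula for the boundary probabilities: a geometric term and the moments of a measure
on the cut between the branch points. -/
lemma boundary_eq (hπ : IsStationary p q μh μl π)
    (hη : 1 ≤ eta1 p q μh μl * y0 p q μh) : ∀ n : ℕ,
    π (0, n) = pi00 p q μh μl / (2 * (1 - p) * μl) / (q * (-eta2 p q μh μl)) *
      (numer p q μh μl (eta1 p q μh μl)⁻¹ /
        (((eta1 p q μh μl)⁻¹ - -((1 - q) / q)) *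
          ((eta1 p q μh μl)⁻¹ - (eta2 p q μh μl)⁻¹)) * eta1 p q μh μl ^ n +
        ((1 - p) - μh) * q / Real.pi / eta1 p q μh μl * cutMoment p q μh μl n) := by
  have hp := P.p_lt_one
  have hq := P.q_lt_one
  have hl := P.l_pos
  have hq0 := P.q_pos
  have hη1 := P.eta1_pos
  have hη2 := P.eta2_neg
  have hη1' := P.eta1_lt_one
  have ha := P.one_lt_y0
  have hab := P.y0_lt_y1
  have hT := transProb_nonneg P.p_pos.le hp.le hq0.le hq.le P.h_pos.le P.h_lt_one.le hl.le
    P.l_lt_one.le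
  have hD : ∀ y ∈ Ioo (0 : ℝ) 1, 0 ≤ kernelDisc p q μh y := fun y hy =>
    P.kernelDisc_nonneg (hy.2.trans ha).le
  have h00 := hπ.apply_zero hT P.p_pos hp hq0 hq P.h_pos hl P.p_lt_h hD
  have hζ₃a : (eta1 p q μh μl)⁻¹ ≤ y0 p q μh := by
    rw [inv_le_iff_one_le_mul₀ hη1]; linarith
  refine coeff_unique (f := boundaryGen π)
    (fun y hy => (hπ.summable_boundaryGen hy.1.le hy.2.le).hasSum) (fun y hy => ?_)
  have hdiv := division_formula (zero_lt_one.trans ha) hab P.node_neg (inv_lt_zero.2 hη2)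
    (inv_pos.2 hη1) hζ₃a (N := numer p q μh μl) (d := ((1 - p) - μh) * q)
    (α₂ := ((1 - p) + μh - 2 * (1 - p) * μl) * q)
    (α₁ := ((1 - p) + μh - 2 * (1 - p) * μl) * (1 - q) + 2 * (1 - p) * q * μl - 1)
    (α₀ := 2 * (1 - p) * (1 - q) * μl)
    (K := fun y => 2 * q * μl * (1 - p) * (1 - y) * (1 - eta1 p q μh μl * y) * (-eta2 p q μh μl))
    (fun y _ => by rw [numer, P.sqrt_kernelDisc, F, mul_left_comm y, mul_assoc _ y]) (by fun_prop)
    (fun y hy => P.numer_bound hy) hy.1 (hy.2.trans ha)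
  have hgeo := hasSum_geometric_of_lt_one (r := eta1 p q μh μl * y) (mul_pos hη1 hy.1).le
    (by nlinarith [hy.1, hy.2])
  have hmom := hasSum_cutIntegral (zero_lt_one.trans ha) hab hζ₃a hy.1 (hy.2.trans ha)
    P.continuousOn_cutDensity
  have hfe := hπ.boundaryGen_mul_etaPoly hT P.p_pos hp hq0 hq P.h_pos hy.1 hy.2 (hD y hy)
  rw [h00, P.etaPoly_eq] at hfe
  change _ = _ * numer p q μh μl y at hfe
  have hC : (fun t => t * ((t - -((1 - q) / q))⁻¹ * (t - (eta2 p q μh μl)⁻¹)⁻¹) / (t - y) /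
      (t - (eta1 p q μh μl)⁻¹)) = fun t => t * cutDensity p q μh μl t / (t - y) /
      (t - (eta1 p q μh μl)⁻¹) := rfl
  rw [hC] at hdiv
  set C := cutIntegral (y0 p q μh) (y1 p q μh) (fun t => t * cutDensity p q μh μl t / (t - y) /
    (t - (eta1 p q μh μl)⁻¹))
  set R := numer p q μh μl (eta1 p q μh μl)⁻¹ / (((eta1 p q μh μl)⁻¹ - -((1 - q) / q)) *
    ((eta1 p q μh μl)⁻¹ - (eta2 p q μh μl)⁻¹))
  have hB : boundaryGen π y = pi00 p q μh μl / (2 * (1 - p) * μl) / (q * (-eta2 p q μh μl)) *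
      (R * (1 - eta1 p q μh μl * y)⁻¹ +
        ((1 - p) - μh) * q / Real.pi / eta1 p q μh μl * C) := by
    have h1 : 1 - eta1 p q μh μl * y ≠ 0 := by nlinarith [hy.1, hy.2]
    have h2 : 0 < 1 - eta2 p q μh μl * y := by nlinarith [hy.1]
    have h3 : 0 < q * y + (1 - q) := by nlinarith [hy.1]
    have h4 : 0 < 1 - p := by linarith
    have h5 : 0 < 1 - q := by linarith
    have h6 : 2 * (q * y + (1 - q)) * ((1 - p) * (1 - q) * μl ^ 2 *
      ((1 - eta1 p q μh μl * y) * (1 - eta2 p q μh μl * y))) ≠ 0 := by positivity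
    refine mul_right_cancel₀ h6 ?_
    have e1 : y - -((1 - q) / q) = (q * y + (1 - q)) / q := by
      field_simp; ring
    have e2 : y - (eta2 p q μh μl)⁻¹ = (1 - eta2 p q μh μl * y) / (-eta2 p q μh μl) := by
      have := hη2.ne
      field_simp; ring
    have e3 : y - (eta1 p q μh μl)⁻¹ = -(1 - eta1 p q μh μl * y) / (eta1 p q μh μl) := by
      field_simp; ring
    rw [hfe, hdiv, e1, e2, e3]
    have := hη2.ne
    have := Real.pi_pos.ne'
    generalize (1 - eta1 p q μh μl * y) = z at *
    field_simp
    ring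
  rw [hB]
  convert! ((hgeo.mul_left R).add (hmom.mul_left
    (((1 - p) - μh) * q / Real.pi / eta1 p q μh μl))).mul_left
      (pi00 p q μh μl / (2 * (1 - p) * μl) / (q * (-eta2 p q μh μl))) using 1
  funext n
  rw [mul_pow, ← cutMoment]
  ring

/-! ### The position of the pole relative to the branch point -/

lemma kernelDisc_y0 : kernelDisc p q μh (y0 p q μh) = 0 := by
  rw [P.kernelDisc_eq, sub_self, zero_mul, mul_zero]

/-- Beyond `y = 1` the factor `1 - η₁ y` carries the sign of `F² - y² Δ`. -/
lemma F_sq_sub_eq {y : ℝ} (hy : 1 < y) : ∃ K : ℝ, 0 < K ∧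
    F p q μh μl y ^ 2 - y ^ 2 * kernelDisc p q μh y = K * (eta1 p q μh μl * y - 1) := by
  have hp := sub_pos.2 P.p_lt_one
  have hq := sub_pos.2 P.q_lt_one
  have hl := P.l_pos
  have hq0 := P.q_pos
  have hη2 := P.eta2_neg
  refine ⟨4 * (1 - p) * (q * y + (1 - q)) * (y - 1) * ((1 - p) * (1 - q) * μl ^ 2) *
    (1 - eta2 p q μh μl * y), ?_, ?_⟩
  · have h1 : 0 < y - 1 := by linarith
    have h2 : 0 < 1 - eta2 p q μh μl * y := by nlinarith
    have h3 : 0 < q * y + (1 - q) := by nlinarith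
    positivity
  · rw [F_sq_sub, P.etaPoly_eq]; ring

lemma one_le_eta1_mul_y0 : 1 ≤ eta1 p q μh μl * y0 p q μh := by
  obtain ⟨K, hK, h⟩ := P.F_sq_sub_eq (μl := μl) P.one_lt_y0
  rw [P.kernelDisc_y0] at h
  have : 0 ≤ K * (eta1 p q μh μl * y0 p q μh - 1) := by
    rw [← h]
    nlinarith [sq_nonneg (F p q μh μl (y0 p q μh))]
  linarith [nonneg_of_mul_nonneg_right this hK]

lemma one_lt_eta1_mul_y0 (hF : F p q μh μl (y0 p q μh) ≠ 0) :
    1 < eta1 p q μh μl * y0 p q μh := by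
  refine lt_of_le_of_ne P.one_le_eta1_mul_y0 fun h => hF ?_
  obtain ⟨K, hK, h'⟩ := P.F_sq_sub_eq (μl := μl) P.one_lt_y0
  rw [P.kernelDisc_y0, ← h] at h'
  exact pow_eq_zero_iff two_ne_zero |>.1 (by linarith)

lemma eta1_mul_y0_eq (hF : F p q μh μl (y0 p q μh) = 0) : eta1 p q μh μl * y0 p q μh = 1 := by
  obtain ⟨K, hK, h'⟩ := P.F_sq_sub_eq (μl := μl) P.one_lt_y0
  rw [P.kernelDisc_y0, hF] at h'
  have : K * (eta1 p q μh μl * y0 p q μh - 1) = 0 := by linarith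
  linarith [(mul_eq_zero.1 this).resolve_left hK.ne']

lemma one_lt_inv_eta1 : 1 < (eta1 p q μh μl)⁻¹ := (one_lt_inv₀ P.eta1_pos).2 P.eta1_lt_one

lemma inv_eta1_lt_y0 (hF : F p q μh μl (y0 p q μh) ≠ 0) : (eta1 p q μh μl)⁻¹ < y0 p q μh := by
  rw [inv_lt_iff_one_lt_mul₀ P.eta1_pos]
  linarith [P.one_lt_eta1_mul_y0 hF]

/-- On `(1 / η₁, y₀]` the polynomial `F` has no zero. -/
lemma F_ne_zero {y : ℝ} (hy : (eta1 p q μh μl)⁻¹ < y) (hy0 : y ≤ y0 p q μh) :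
    F p q μh μl y ≠ 0 := by
  intro h
  obtain ⟨K, hK, h'⟩ := P.F_sq_sub_eq (μl := μl) (P.one_lt_inv_eta1.trans hy)
  have h1 := P.kernelDisc_nonneg hy0
  have h2 : 0 < eta1 p q μh μl * y - 1 := by
    have := (inv_lt_iff_one_lt_mul₀ P.eta1_pos).1 hy
    linarith
  rw [h] at h'
  nlinarith [mul_pos hK h2, mul_nonneg (sq_nonneg y) h1]

lemma F_sq_inv_eta1 : F p q μh μl (eta1 p q μh μl)⁻¹ ^ 2 =
    ((eta1 p q μh μl)⁻¹) ^ 2 * kernelDisc p q μh (eta1 p q μh μl)⁻¹ := by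
  obtain ⟨K, hK, h'⟩ := P.F_sq_sub_eq (μl := μl) P.one_lt_inv_eta1
  rw [mul_inv_cancel₀ P.eta1_pos.ne', sub_self, mul_zero] at h'
  linarith

lemma numer_inv_eta1 : numer p q μh μl (eta1 p q μh μl)⁻¹ =
    F p q μh μl (eta1 p q μh μl)⁻¹ + |F p q μh μl (eta1 p q μh μl)⁻¹| := by
  rw [numer, ← Real.sqrt_sq_eq_abs, P.F_sq_inv_eta1, Real.sqrt_mul (sq_nonneg _),
    Real.sqrt_sq (inv_pos.2 P.eta1_pos).le]

/-- If `F(y₀) > 0`, the numerator does not vanish at the pole. -/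
lemma F_inv_eta1_pos (hF : 0 < F p q μh μl (y0 p q μh)) :
    0 < F p q μh μl (eta1 p q μh μl)⁻¹ := by
  have hlt := P.inv_eta1_lt_y0 hF.ne'
  have h1 : 0 < F p q μh μl (eta1 p q μh μl)⁻¹ ^ 2 := by
    rw [P.F_sq_inv_eta1, P.kernelDisc_eq]
    have h1 := P.e_pos
    have h2 := P.q_pos
    have h3 := inv_pos.2 P.eta1_pos
    have h4 := P.y0_lt_y1
    have h5 := sub_pos.2 hlt
    have h6 := sub_pos.2 (hlt.trans h4)
    positivity
  by_contra! h
  have h2 : F p q μh μl (eta1 p q μh μl)⁻¹ < 0 :=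
    lt_of_le_of_ne h fun h0 => by rw [h0] at h1; norm_num at h1
  have hc : ContinuousOn (F p q μh μl) (Icc (eta1 p q μh μl)⁻¹ (y0 p q μh)) := by
    unfold F; fun_prop
  obtain ⟨c, hc1, hc2⟩ := intermediate_value_Ioo hlt.le hc ⟨h2, hF⟩
  exact P.F_ne_zero hc1.1 hc1.2.le hc2

/-- If `F(y₀) ≤ 0`, the numerator vanishes at `1 / η₁`, so that there is no pole. -/
lemma numer_inv_eta1_eq_zero (hF : F p q μh μl (y0 p q μh) ≤ 0) :
    numer p q μh μl (eta1 p q μh μl)⁻¹ = 0 := by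
  suffices h : F p q μh μl (eta1 p q μh μl)⁻¹ ≤ 0 by
    rw [P.numer_inv_eta1, abs_of_nonpos h, add_neg_cancel]
  rcases hF.eq_or_lt with h0 | hneg
  · rw [inv_eq_of_mul_eq_one_right (P.eta1_mul_y0_eq h0), h0]
  · by_contra! h
    have hlt := P.inv_eta1_lt_y0 hneg.ne
    have hc : ContinuousOn (F p q μh μl) (Icc (eta1 p q μh μl)⁻¹ (y0 p q μh)) := by
      unfold F; fun_prop
    obtain ⟨c, hc1, hc2⟩ := intermediate_value_Ioo' hlt.le hc ⟨hneg, h⟩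
    exact P.F_ne_zero hc1.1 hc1.2.le hc2

/-! ### Asymptotics of the moments and the three regimes -/

lemma pi00_pos : 0 < pi00 p q μh μl :=
  div_pos (sub_pos.2 P.rho_lt) (mul_pos (sub_pos.2 P.p_lt_one) (sub_pos.2 P.q_lt_one))

lemma scale_pos : 0 < pi00 p q μh μl / (2 * (1 - p) * μl) :=
  div_pos P.pi00_pos (mul_pos (mul_pos two_pos (sub_pos.2 P.p_lt_one)) P.l_pos)

lemma cutDensity_y0 : cutDensity p q μh μl (y0 p q μh) =
    q * (-eta2 p q μh μl) /
      ((q * y0 p q μh + (1 - q)) * (1 - eta2 p q μh μl * y0 p q μh)) := by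
  have h0 := P.one_lt_y0
  have hq := P.q_pos
  have hη2 := P.eta2_neg
  have e1 : y0 p q μh - -((1 - q) / q) = (q * y0 p q μh + (1 - q)) / q := by
    field_simp; ring
  have e2 : y0 p q μh - (eta2 p q μh μl)⁻¹ =
      (1 - eta2 p q μh μl * y0 p q μh) / (-eta2 p q μh μl) := by
    have := hη2.ne
    field_simp; ring
  rw [cutDensity, e1, e2, inv_div, inv_div, div_mul_div_comm]

lemma tendsto_cutMoment (hF : F p q μh μl (y0 p q μh) ≠ 0) :
    Tendsto (fun n : ℕ => √(n : ℝ) ^ 3 * (y0 p q μh ^ n * cutMoment p q μh μl n)) atTop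
      (𝓝 (cutDensity p q μh μl (y0 p q μh) / (y0 p q μh - (eta1 p q μh μl)⁻¹) *
        (√Real.pi / 2 * (y0 p q μh * √(y0 p q μh * (y1 p q μh - y0 p q μh)))))) := by
  have h := tendsto_cutIntegral_pow (zero_lt_one.trans P.one_lt_y0) P.y0_lt_y1
    (continuousOn_div_sub (P.inv_eta1_lt_y0 hF) P.continuousOn_cutDensity)
  simp only [cutMoment]
  simp only [div_mul_eq_mul_div] at h ⊢
  exact h

lemma tendsto_cutMoment_of_eq (hF : F p q μh μl (y0 p q μh) = 0) :
    Tendsto (fun n : ℕ => √(n : ℝ) * (y0 p q μh ^ n * cutMoment p q μh μl n)) atTop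
      (𝓝 (cutDensity p q μh μl (y0 p q μh) *
        (√Real.pi * √(y0 p q μh * (y1 p q μh - y0 p q μh))))) := by
  have h := tendsto_cutIntegral_pow_div (zero_lt_one.trans P.one_lt_y0) P.y0_lt_y1
    P.continuousOn_cutDensity
  simp only [cutMoment]
  rw [inv_eq_of_mul_eq_one_right (P.eta1_mul_y0_eq hF)]
  exact h

lemma weight_y0_pos : 0 < q * y0 p q μh + (1 - q) := by
  nlinarith [P.one_lt_y0, P.q_pos]

lemma one_sub_eta2_mul_y0_pos : 0 < 1 - eta2 p q μh μl * y0 p q μh := by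
  nlinarith [P.one_lt_y0, P.eta2_neg]

lemma sqrt_cut_pos : 0 < √(y0 p q μh * (y1 p q μh - y0 p q μh)) :=
  Real.sqrt_pos.2 (mul_pos (zero_lt_one.trans P.one_lt_y0) (sub_pos.2 P.y0_lt_y1))

lemma Cl1_eq : Cl1 p q μh μl = pi00 p q μh μl / (2 * (1 - p) * μl) / (q * (-eta2 p q μh μl)) *
      (2 * F p q μh μl (eta1 p q μh μl)⁻¹ /
        (((eta1 p q μh μl)⁻¹ - -((1 - q) / q)) *
          ((eta1 p q μh μl)⁻¹ - (eta2 p q μh μl)⁻¹))) := by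
  have hq := P.q_pos
  have hq1 := sub_pos.2 P.q_lt_one
  have hη1 := P.eta1_pos
  have hη2 := P.eta2_neg
  have hd : 0 < eta1 p q μh μl - eta2 p q μh μl := by linarith
  have e1 : (eta1 p q μh μl)⁻¹ - -((1 - q) / q) = (q * (eta1 p q μh μl)⁻¹ + (1 - q)) / q := by
    field_simp; ring
  have e2 : (eta1 p q μh μl)⁻¹ - (eta2 p q μh μl)⁻¹ =
      (eta1 p q μh μl - eta2 p q μh μl) / (eta1 p q μh μl * (-eta2 p q μh μl)) := by
    have := hη2.ne
    field_simp; ring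
  have hw : 0 < q * (eta1 p q μh μl)⁻¹ + (1 - q) := by positivity
  have := hη2.ne
  rw [Cl1, coeffA, one_div, e1, e2]
  generalize q * (eta1 p q μh μl)⁻¹ + (1 - q) = w at *
  field_simp

lemma Cl1_pos (hF : 0 < F p q μh μl (y0 p q μh)) : 0 < Cl1 p q μh μl := by
  have hq := P.q_pos
  have hq1 := sub_pos.2 P.q_lt_one
  have hη1 := P.eta1_pos
  have hη2 := P.eta2_neg
  have hd : 0 < eta1 p q μh μl - eta2 p q μh μl := by linarith
  have hF' := P.F_inv_eta1_pos hF
  have := P.scale_pos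
  rw [Cl1, coeffA, one_div]
  positivity

lemma Cl2_eq (hF : F p q μh μl (y0 p q μh) = 0) :
    Cl2 p q μh μl = pi00 p q μh μl / (2 * (1 - p) * μl) / (q * (-eta2 p q μh μl)) *
      (((1 - p) - μh) * q / Real.pi / eta1 p q μh μl *
        (cutDensity p q μh μl (y0 p q μh) *
          (√Real.pi * √(y0 p q μh * (y1 p q μh - y0 p q μh))))) := by
  have hη := P.eta1_mul_y0_eq hF
  have hy0 : 0 < y0 p q μh := zero_lt_one.trans P.one_lt_y0
  have h1 : eta1 p q μh μl = (y0 p q μh)⁻¹ := eq_inv_of_mul_eq_one_left hη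
  have h2 := P.one_sub_eta2_mul_y0_pos
  have h3 := P.weight_y0_pos
  have hq := P.q_pos
  have hη2 := P.eta2_neg.ne
  have hpi : √Real.pi ^ 2 = Real.pi := Real.sq_sqrt Real.pi_pos.le
  have hpi0 : 0 < √Real.pi := Real.sqrt_pos.2 Real.pi_pos
  have e : (y0 p q μh)⁻¹ - eta2 p q μh μl = (1 - eta2 p q μh μl * y0 p q μh) / y0 p q μh := by
    field_simp
  rw [Cl2, coeffA, P.cutDensity_y0, h1, e]
  generalize q * y0 p q μh + (1 - q) = w at *
  generalize 1 - eta2 p q μh μl * y0 p q μh = v at *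
  generalize √(y0 p q μh * (y1 p q μh - y0 p q μh)) = S at *
  generalize √Real.pi = r at *
  rw [← hpi]
  field_simp

lemma Cl2_pos : 0 < Cl2 p q μh μl := by
  have hη1 := P.eta1_pos
  have hη2 := P.eta2_neg
  have hd : 0 < eta1 p q μh μl - eta2 p q μh μl := by linarith
  have := P.scale_pos
  have := P.e_pos
  have := P.q_pos
  have hy0 : 0 < y0 p q μh := zero_lt_one.trans P.one_lt_y0
  have := P.sqrt_cut_pos
  have := P.weight_y0_pos
  have := Real.pi_pos
  rw [Cl2, coeffA]
  positivity

lemma Cl3_eq (hF : F p q μh μl (y0 p q μh) ≠ 0) :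
    Cl3 p q μh μl = pi00 p q μh μl / (2 * (1 - p) * μl) / (q * (-eta2 p q μh μl)) *
      (((1 - p) - μh) * q / Real.pi / eta1 p q μh μl *
        (cutDensity p q μh μl (y0 p q μh) / (y0 p q μh - (eta1 p q μh μl)⁻¹) *
        (√Real.pi / 2 * (y0 p q μh * √(y0 p q μh * (y1 p q μh - y0 p q μh)))))) := by
  have h1 := P.one_lt_eta1_mul_y0 hF
  have h1' : 1 - eta1 p q μh μl * y0 p q μh ≠ 0 := by linarith
  have h2 := P.one_sub_eta2_mul_y0_pos
  have h3 := P.weight_y0_pos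
  have hq := P.q_pos
  have hη1 := P.eta1_pos
  have hη2 := P.eta2_neg.ne
  have hd : eta1 p q μh μl - eta2 p q μh μl ≠ 0 := by linarith [P.eta2_neg]
  have hpi : √Real.pi ^ 2 = Real.pi := Real.sq_sqrt Real.pi_pos.le
  have hpi0 : 0 < √Real.pi := Real.sqrt_pos.2 Real.pi_pos
  have e : y0 p q μh - (eta1 p q μh μl)⁻¹ =
      -(1 - eta1 p q μh μl * y0 p q μh) / eta1 p q μh μl := by
    field_simp; ring
  have hab : coeffA p q μh μl /
        ((q * y0 p q μh + (1 - q)) * (1 - eta1 p q μh μl * y0 p q μh)) +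
      coeffB p q μh μl / ((q * y0 p q μh + (1 - q)) * (1 - eta2 p q μh μl * y0 p q μh)) =
      pi00 p q μh μl / (2 * (1 - p) * μl) / ((q * y0 p q μh + (1 - q)) *
        ((1 - eta1 p q μh μl * y0 p q μh) * (1 - eta2 p q μh μl * y0 p q μh))) := by
    rw [coeffA, coeffB, ← neg_sub (eta1 p q μh μl) (eta2 p q μh μl)]
    generalize pi00 p q μh μl / (2 * (1 - p) * μl) = c at *
    have h2' := h2.ne'
    field_simp
    ring
  rw [Cl3, hab, P.cutDensity_y0, e]
  generalize q * y0 p q μh + (1 - q) = w at *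
  generalize 1 - eta2 p q μh μl * y0 p q μh = v at *
  generalize 1 - eta1 p q μh μl * y0 p q μh = u at *
  generalize √(y0 p q μh * (y1 p q μh - y0 p q μh)) = S at *
  generalize pi00 p q μh μl / (2 * (1 - p) * μl) = c at *
  generalize √Real.pi = r at *
  rw [← hpi]
  field_simp
  ring

lemma Cl3_pos (hF : F p q μh μl (y0 p q μh) ≠ 0) : 0 < Cl3 p q μh μl := by
  have h1 := sub_pos.2 (P.inv_eta1_lt_y0 hF)
  have h2 := P.one_sub_eta2_mul_y0_pos
  have h3 := P.weight_y0_pos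
  have hq := P.q_pos
  have hη1 := P.eta1_pos
  have hη2 := neg_pos.2 P.eta2_neg
  have := P.scale_pos
  have := P.e_pos
  have hy0 : 0 < y0 p q μh := zero_lt_one.trans P.one_lt_y0
  have := P.sqrt_cut_pos
  have := Real.pi_pos
  rw [P.Cl3_eq hF, P.cutDensity_y0]
  positivity

/-- If `F(y₀) > 0`, the pole `1 / η₁ < y₀` gives exact geometric decay. -/
lemma regime_pole (hπ : IsStationary p q μh μl π) (hF : 0 < F p q μh μl (y0 p q μh)) :
    Tendsto (fun j : ℕ => π (0, j) / (Cl1 p q μh μl * eta1 p q μh μl ^ j)) atTop (𝓝 1) := by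
  have hη1 := P.eta1_pos
  have hy0 : 0 < y0 p q μh := zero_lt_one.trans P.one_lt_y0
  have hC := P.Cl1_pos hF
  have hη := P.one_lt_eta1_mul_y0 hF.ne'
  have hN : numer p q μh μl (eta1 p q μh μl)⁻¹ = 2 * F p q μh μl (eta1 p q μh μl)⁻¹ := by
    rw [P.numer_inv_eta1, abs_of_pos (P.F_inv_eta1_pos hF)]; ring
  have hb := P.boundary_eq hπ P.one_le_eta1_mul_y0
  have h1 := P.Cl1_eq
  set c := pi00 p q μh μl / (2 * (1 - p) * μl) / (q * (-eta2 p q μh μl))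
  set k := ((1 - p) - μh) * q / Real.pi / eta1 p q μh μl
  have hpow : Tendsto (fun n : ℕ => (eta1 p q μh μl * y0 p q μh)⁻¹ ^ n) atTop (𝓝 0) :=
    tendsto_pow_atTop_nhds_zero_of_lt_one (by positivity) (inv_lt_one_of_one_lt₀ hη)
  have hsq : Tendsto (fun n : ℕ => (√(n : ℝ))⁻¹ ^ 3) atTop (𝓝 0) := by
    have := (tendsto_inv_atTop_zero.comp
      (Real.tendsto_sqrt_atTop.comp tendsto_natCast_atTop_atTop)).pow 3
    simpa [Function.comp_def] using this
  have h := ((((P.tendsto_cutMoment hF.ne').mul hsq).mul hpow).const_mul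
    (c * k / Cl1 p q μh μl)).const_add 1
  simp only [mul_zero, add_zero] at h
  refine h.congr' ?_
  filter_upwards [eventually_gt_atTop 0] with n hn
  have hn' : 0 < √(n : ℝ) := Real.sqrt_pos.2 (by exact_mod_cast hn)
  rw [hb n, hN, mul_add, ← mul_assoc c, ← h1, mul_inv, mul_pow, inv_pow, inv_pow, inv_pow]
  field_simp

/-- If `F(y₀) = 0`, the pole coincides with the branch point `y₀`, and the density on the cut has a
singularity of order `-1/2` there. -/
lemma regime_critical (hπ : IsStationary p q μh μl π) (hF : F p q μh μl (y0 p q μh) = 0) :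
    Tendsto (fun j : ℕ => π (0, j) /
      (Cl2 p q μh μl * (j : ℝ) ^ (-(1 / 2) : ℝ) * (y0 p q μh)⁻¹ ^ j)) atTop (𝓝 1) := by
  have hy0 : 0 < y0 p q μh := zero_lt_one.trans P.one_lt_y0
  have hC := P.Cl2_pos
  have h := (((P.tendsto_cutMoment_of_eq hF).const_mul
    (((1 - p) - μh) * q / Real.pi / eta1 p q μh μl)).const_mul
      (pi00 p q μh μl / (2 * (1 - p) * μl) / (q * (-eta2 p q μh μl)))).div_const (Cl2 p q μh μl)
  rw [← P.Cl2_eq hF, div_self hC.ne'] at h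
  refine h.congr' ?_
  filter_upwards [eventually_gt_atTop 0] with n hn
  have hn0 : (0 : ℝ) < n := by exact_mod_cast hn
  have hn' : 0 < √(n : ℝ) := Real.sqrt_pos.2 hn0
  rw [P.boundary_eq hπ P.one_le_eta1_mul_y0 n, P.numer_inv_eta1_eq_zero hF.le, zero_div, zero_mul,
    zero_add, Real.rpow_neg hn0.le, ← Real.sqrt_eq_rpow, inv_pow]
  field_simp

/-- If `F(y₀) < 0`, there is no pole, and the square root at `y₀` determines the decay. -/
lemma regime_branch (hπ : IsStationary p q μh μl π) (hF : F p q μh μl (y0 p q μh) < 0) :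
    Tendsto (fun j : ℕ => π (0, j) /
      (Cl3 p q μh μl * (j : ℝ) ^ (-(3 / 2) : ℝ) * (y0 p q μh)⁻¹ ^ j)) atTop (𝓝 1) := by
  have hy0 : 0 < y0 p q μh := zero_lt_one.trans P.one_lt_y0
  have hC := P.Cl3_pos hF.ne
  have h := (((P.tendsto_cutMoment hF.ne).const_mul
    (((1 - p) - μh) * q / Real.pi / eta1 p q μh μl)).const_mul
      (pi00 p q μh μl / (2 * (1 - p) * μl) / (q * (-eta2 p q μh μl)))).div_const (Cl3 p q μh μl)
  rw [← P.Cl3_eq hF.ne, div_self hC.ne'] at h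
  refine h.congr' ?_
  filter_upwards [eventually_gt_atTop 0] with n hn
  have hn0 : (0 : ℝ) < n := by exact_mod_cast hn
  have hn' : 0 < √(n : ℝ) := Real.sqrt_pos.2 hn0
  have hr : (n : ℝ) ^ (-(3 / 2) : ℝ) = (√(n : ℝ) ^ 3)⁻¹ := by
    rw [Real.rpow_neg hn0.le, Real.sqrt_eq_rpow, ← Real.rpow_natCast, ← Real.rpow_mul hn0.le]
    norm_num
  rw [P.boundary_eq hπ P.one_le_eta1_mul_y0 n, P.numer_inv_eta1_eq_zero hF.le, zero_div, zero_mul,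
    zero_add, hr, inv_pow]
  field_simp

end Params

end PriorityQueue

theorem theorem5p1 (p q μh μl : ℝ)
    (hp : 0 < p) (hq : 0 < q) (hμh : 0 < μh) (hμl : 0 < μl)
    (hsum : p + q + μh + μl = 1) (hle : μl ≤ μh)
    (hρ : PriorityQueue.rho p q μh μl < 1)
    (π : ℕ × ℕ → ℝ) (hπ : PriorityQueue.IsStationary p q μh μl π) :
    (0 < PriorityQueue.F p q μh μl (PriorityQueue.y0 p q μh) →
      Filter.Tendsto
        (fun j : ℕ => π (0, j) /
          (PriorityQueue.Cl1 p q μh μl * PriorityQueue.eta1 p q μh μl ^ j))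
        Filter.atTop (nhds 1)) ∧
    (PriorityQueue.F p q μh μl (PriorityQueue.y0 p q μh) = 0 →
      Filter.Tendsto
        (fun j : ℕ => π (0, j) /
          (PriorityQueue.Cl2 p q μh μl * (j : ℝ) ^ (-(1 / 2) : ℝ) *
            (PriorityQueue.y0 p q μh)⁻¹ ^ j))
        Filter.atTop (nhds 1)) ∧
    (PriorityQueue.F p q μh μl (PriorityQueue.y0 p q μh) < 0 →
      Filter.Tendsto
        (fun j : ℕ => π (0, j) /
          (PriorityQueue.Cl3 p q μh μl * (j : ℝ) ^ (-(3 / 2) : ℝ) *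
            (PriorityQueue.y0 p q μh)⁻¹ ^ j))
        Filter.atTop (nhds 1)) := by
  have P : PriorityQueue.Params p q μh μl := ⟨hp, hq, hμh, hμl, hsum, hle, hρ⟩
  exact ⟨P.regime_pole hπ, P.regime_critical hπ, P.regime_branch hπ⟩
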